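/- **Setting.** For $x,y\in\mathbb Z^d$ write $x\sim y$ if $\sum_i|x_i-y_i|=1$. For finite $\Lambda\subset\mathbb Z^d$ let $\partial\Lambda$ be the set of $y\notin\Lambda$ with $y\sim x$ for some $x\in\Lambda$, and let $\Lambda_N=[-N,N]^d\cap\mathbb Z^d$. Let $(\Omega,\mathcal F,\mathbb P)$ be a probability space. *Model A.* $V\in C^2(\mathbb R)$ is even, $V(s)\ge As^2-B$ and $V''(s)\le C_2$ for all $s\in\mathbb R$, with $A,C_2>0$ and $B\in\mathbb R$; $(\xi(x))_{x\in\mathbb Z^d}$ are i.i.d. real random variables. For a boundary condition $\psi\in\mathbb R^{\mathbb Z^d}$, $$H_\Lambda^\psi[\xi](\phi)=\tfrac12\sum_{x,y\in\Lambda,\,x\sim y}V(\phi(x)-\phi(y))+\sum_{x\in\Lambda,\,y\in\partial\Lambda,\,x\sim y}V(\phi(x)-\psi(y))-\sum_{x\in\Lambda}\xi(x)\phi(x).$$ *Model B.* To the bonds $(x,y)$, $x\sim y$, are attached i.i.d. random even functions $V^\omega_{(x,y)}\in C^2(\mathbb R)$, jointly measurable in $(\omega,s)$, and i.i.d. integrable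 random variables $B^\omega_{(x,y)}$, such that for $\mathbb P$-a.e. $\omega$, $As^2-B^\omega_{(x,y)}\le V^\omega_{(x,y)}(s)\le C_2s^2$ for all bonds and all $s$, where $A,C_2>0$ are constants. (The bonds may be directed, or undirected with $V_{(x,y)}=V_{(y,x)}$, $B_{(x,y)}=B_{(y,x)}$.) Here $$H_\Lambda^\psi[\omega](\phi)=\tfrac12\sum_{x,y\in\Lambda,\,x\sim y}V^\omega_{(x,y)}(\phi(x)-\phi(y))+\sum_{x\in\Lambda,\,y\in\partial\Lambda,\,x\sim y}V^\omega_{(x,y)}(\phi(x)-\psi(y)).$$ *Gibbs measures.* In both models let $\nu_\Lambda^\psi=Z^{-1}e^{-H_\Lambda^\psi(\phi)}\prod_{x\in\Lambda}d\phi(x)\prod_{x\notin\Lambda}\delta_{\psi(x)}(d\phi(x))$. For $u\in\mathbb R^d$ put $\psi_u(x)=u\cdot x$, $\rho_u=\nabla\psi_u$, let $\mu_\Lambda^{\rho_u}$ be the law of the gradient field $\nabla\phi=(\phi(y)-\phi(x))_{x\sim y}$ under $\nu_\Lambda^{\psi_u}$, and $\bar\mu_\Lambda^u=|\Lambda|^{-1}\sum_{x\in\Lambda}\mu_{\Lambda+x}^{\rho_u}$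 (with the disorder held fixed). Let $$D_N=\frac1{2|\Lambda_N|}\sum_{x,y\in\Lambda_N,\,x\sim y}\bigl(\phi(x)-\phi(y)-u\cdot(x-y)\bigr)^2 .$$ **Proposition.** (A) Model A. Let $d\ge3$, $\mathbb E\,\xi(0)=0$, $\mathbb E\,\xi(0)^2<\infty$ and $u\in\mathbb R^d$. There are nonrandom constants $\beta,t_0>0$ such that for $\mathbb P$-a.e. $\xi$ and for all but finitely many $N$ (how many may depend on $\xi$), $\mu_{\Lambda_N}^{\rho_u}[\xi]$ and $\bar\mu^u_{\Lambda_N}[\xi]$ are well-defined probability measures and, for all $t>t_0$, $$\mu_{\Lambda_N}^{\rho_u}[\xi](D_N>t)\le e^{-\beta|\Lambda_N|t}\qquad\text{and}\qquad\bar\mu_{\Lambda_N}^{u}[\xi](D_N>t)\le e^{-\beta|\Lambda_N|t}.$$ (B) Model B. Let $d\ge1$ and $u\in\mathbb R^d$. There are nonrandom constants $\beta,t_0>0$ such that for $\mathbb P$-a.e. $\omega$ the assertions of (A) hold, with $\mu_{\Lambda_N}^{\rho_u}[\omega]$ and $\bar\mu^u_{\Lambda_N}[\omega]$ in place of the measures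 of model A: for all but finitely many $N$ (depending on $\omega$) and all $t>t_0$; and also, for some $t_1=t_1(\omega)>0$, for all $N$ and all $t>t_1$. If moreover there is a constant $b$ such that almost surely $B_{(x,y)}\le b$ for all bonds, then for $\mathbb P$-a.e. $\omega$ they hold for all $N\in\mathbb N$ and all $t>t_0$. -/

import Mathlib

open MeasureTheory ProbabilityTheory Filter
open scoped ENNReal

noncomputable section

namespace Interface

/-! ### The lattice -/

/-- Sites of the lattice `ℤ^d`. -/
abbrev Site (d : ℕ) : Type := Fin d → ℤ

/-- Nearest neighbours: `∑ i, |x_i - y_i| = 1`. -/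
def Adj {d : ℕ} (x y : Site d) : Prop := ∑ i, |x i - y i| = 1

instance {d : ℕ} (x y : Site d) : Decidable (Adj x y) := by unfold Adj; infer_instance

theorem Adj.symm {d : ℕ} {x y : Site d} (h : Adj x y) : Adj y x := by
  unfold Adj at *
  rw [← h]
  exact Finset.sum_congr rfl fun i _ => abs_sub_comm _ _

/-- Directed bonds `b = (x_b, y_b)`; each undirected bond appears twice. -/
def Bond (d : ℕ) : Type := {b : Site d × Site d // Adj b.1 b.2}

/-- The reversed bond `-b`. -/
def Bond.rev {d : ℕ} (b : Bond d) : Bond d := ⟨(b.1.2, b.1.1), b.2.symm⟩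

/-- The outer boundary `∂Λ`, see `mem_boundary`. -/
def boundary {d : ℕ} (Λ : Finset (Site d)) : Finset (Site d) :=
  (Λ.biUnion fun y => (Finset.Icc (y - 1) (y + 1)).filter fun x => Adj x y) \ Λ

theorem mem_boundary {d : ℕ} (Λ : Finset (Site d)) (x : Site d) :
    x ∈ boundary Λ ↔ x ∉ Λ ∧ ∃ y ∈ Λ, Adj x y := by
  have key : ∀ y : Site d, Adj x y → x ∈ Finset.Icc (y - 1) (y + 1) := by
    intro y h
    have hi : ∀ i, |x i - y i| ≤ 1 := fun i => by
      have := Finset.single_le_sum (f := fun i => |x i - y i|)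
        (fun i _ => abs_nonneg _) (Finset.mem_univ i)
      exact this.trans (le_of_eq h)
    rw [Finset.mem_Icc]
    refine ⟨fun i => ?_, fun i => ?_⟩ <;> have := abs_le.1 (hi i) <;>
      simp only [Pi.sub_apply, Pi.add_apply, Pi.one_apply] <;> linarith
  simp only [boundary, Finset.mem_sdiff, Finset.mem_biUnion, Finset.mem_filter]
  constructor
  · rintro ⟨⟨y, hy, -, h⟩, hx⟩
    exact ⟨hx, y, hy, h⟩
  · rintro ⟨hx, y, hy, h⟩
    exact ⟨⟨y, hy, key y h, h⟩, hx⟩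

/-- The box `Λ_N = [-N, N]^d ∩ ℤ^d`. -/
def box (d N : ℕ) : Finset (Site d) := Finset.Icc (fun _ => -(N : ℤ)) (fun _ => (N : ℤ))

/-- The translated volume `Λ + v`. -/
def translate {d : ℕ} (Λ : Finset (Site d)) (v : Site d) : Finset (Site d) :=
  Λ.image fun z => z + v

/-- The scalar product `u · x` of a tilt and a site. -/
def dot {d : ℕ} (u : Fin d → ℝ) (x : Site d) : ℝ := ∑ i, u i * (x i : ℝ)

/-! ### Height fields and gradient fields -/

/-- The set `χ` of gradient fields: fields on the directed bonds that satisfy the plaquette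
condition. A plaquette is a closed loop of four bonds whose four starting points are distinct. -/
def gradFields (d : ℕ) : Set (Bond d → ℝ) :=
  {η | (∀ b, η b = -η b.rev) ∧
    ∀ b : Fin 4 → Bond d, (∀ i, (b i).1.2 = (b (i + 1)).1.1) →
      Function.Injective (fun i => (b i).1.1) → ∑ i, η (b i) = 0}

/-- The type of gradient fields, with the trace of the product σ-algebra of `ℝ^{bonds}`. -/
abbrev GradField (d : ℕ) : Type := gradFields d

/-- The gradient `∇φ(b) = φ(y_b) - φ(x_b)` of a height field. -/
def grad {d : ℕ} (φ : Site d → ℝ) : GradField d :=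
  ⟨fun b => φ b.1.2 - φ b.1.1, by
    refine ⟨fun b => by simp [Bond.rev], fun b hb _ => ?_⟩
    have h0 := hb 0
    have h1 := hb 1
    have h2 := hb 2
    have h3 := hb 3
    simp only [Fin.isValue, Fin.reduceAdd, zero_add] at h0 h1 h2 h3
    simp only [Fin.sum_univ_four, h0, h1, h2, h3]
    ring⟩

theorem measurable_grad {d : ℕ} : Measurable (grad : (Site d → ℝ) → GradField d) :=
  Measurable.subtype_mk (by
    exact measurable_pi_lambda _ fun b => (measurable_pi_apply _).sub (measurable_pi_apply _))

/-- The height field equal to `φ` on `Λ` and to `ψ` off `Λ`. -/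
def glue {d : ℕ} (Λ : Finset (Site d)) (ψ : Site d → ℝ) (φ : Λ → ℝ) : Site d → ℝ :=
  fun x => if h : x ∈ Λ then φ ⟨x, h⟩ else ψ x

theorem measurable_glue {d : ℕ} (Λ : Finset (Site d)) (ψ : Site d → ℝ) :
    Measurable (glue Λ ψ) := by
  refine measurable_pi_lambda _ fun x => ?_
  by_cases h : x ∈ Λ
  · simpa [glue, h] using measurable_pi_apply (⟨x, h⟩ : Λ)
  · simp [glue, h]

/-! ### Finite-volume Gibbs measures -/

/-- The measure `dφ_Λ δ_ψ(dφ_{ℤ^d ∖ Λ})` on height fields: Lebesgue measure in the coordinates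
in `Λ`, and `φ = ψ` off `Λ`. -/
def refMeasure {d : ℕ} (Λ : Finset (Site d)) (ψ : Site d → ℝ) : Measure (Site d → ℝ) :=
  (volume : Measure (Λ → ℝ)).map (glue Λ ψ)

/-- The partition function of a Hamiltonian `H`. -/
def partitionFn {d : ℕ} (H : (Site d → ℝ) → ℝ) (Λ : Finset (Site d)) (ψ : Site d → ℝ) : ℝ≥0∞ :=
  ∫⁻ φ, ENNReal.ofReal (Real.exp (-H φ)) ∂(refMeasure Λ ψ)

/-- The finite-volume Gibbs measure `Z⁻¹ exp(-H(φ)) dφ_Λ δ_ψ(dφ_{ℤ^d ∖ Λ})`. -/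
def gibbs {d : ℕ} (H : (Site d → ℝ) → ℝ) (Λ : Finset (Site d)) (ψ : Site d → ℝ) :
    Measure (Site d → ℝ) :=
  (partitionFn H Λ ψ)⁻¹ •
    (refMeasure Λ ψ).withDensity fun φ => ENNReal.ofReal (Real.exp (-H φ))

/-- The Hamiltonian `H_Λ^ψ[ξ]` of model A (random fields `ξ`). -/
def hamiltonianA {d : ℕ} (V : ℝ → ℝ) (ξ : Site d → ℝ) (Λ : Finset (Site d)) (ψ : Site d → ℝ)
    (φ : Site d → ℝ) : ℝ :=
  1 / 2 * (∑ x ∈ Λ, ∑ y ∈ Λ with Adj x y, V (φ x - φ y))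
    + (∑ x ∈ Λ, ∑ y ∈ boundary Λ with Adj x y, V (φ x - ψ y))
    - ∑ x ∈ Λ, ξ x * φ x

/-- The Hamiltonian `H_Λ^ψ[ω]` of model B (potentials `W x y` on the bonds; the values of `W`
at pairs that are not bonds are never used). -/
def hamiltonianB {d : ℕ} (W : Site d → Site d → ℝ → ℝ) (Λ : Finset (Site d)) (ψ : Site d → ℝ)
    (φ : Site d → ℝ) : ℝ :=
  1 / 2 * (∑ x ∈ Λ, ∑ y ∈ Λ with Adj x y, W x y (φ x - φ y))
    + (∑ x ∈ Λ, ∑ y ∈ boundary Λ with Adj x y, W x y (φ x - ψ y))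

/-- The finite-volume gradient Gibbs measure of model A with boundary condition `ρ = ∇ψ`:
the law of `∇φ` under the Gibbs measure with boundary condition `ψ`. -/
def gradGibbsA {d : ℕ} (V : ℝ → ℝ) (ξ : Site d → ℝ) (Λ : Finset (Site d)) (ψ : Site d → ℝ) :
    Measure (GradField d) :=
  (gibbs (hamiltonianA V ξ Λ ψ) Λ ψ).map grad

/-- The finite-volume gradient Gibbs measure of model B with boundary condition `ρ = ∇ψ`. -/
def gradGibbsB {d : ℕ} (W : Site d → Site d → ℝ → ℝ) (Λ : Finset (Site d)) (ψ : Site d → ℝ) :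
    Measure (GradField d) :=
  (gibbs (hamiltonianB W Λ ψ) Λ ψ).map grad

/-- The spatial average `|Λ|⁻¹ ∑_{x ∈ Λ} μ_{Λ + x}` of a family `μ` of measures indexed by
finite volumes. -/
def spatialAverage {d : ℕ} (μ : Finset (Site d) → Measure (GradField d)) (Λ : Finset (Site d)) :
    Measure (GradField d) :=
  (Λ.card : ℝ≥0∞)⁻¹ • ∑ x ∈ Λ, μ (translate Λ x)

/-! ### The event -/

/-- The normalized squared tilt deviation
`(1 / (2 |Λ|)) ∑_{x, y ∈ Λ, |x - y| = 1} (φ(x) - φ(y) - u · (x - y))²`, as a function of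
`η = ∇φ`; here `φ(x) - φ(y)` is `η` on the bond from `y` to `x`. -/
def tiltDeviation {d : ℕ} (Λ : Finset (Site d)) (u : Fin d → ℝ) (η : GradField d) : ℝ :=
  1 / (2 * (Λ.card : ℝ)) *
    ∑ x ∈ Λ, ∑ y ∈ Λ, if h : Adj x y then (η.1 ⟨(y, x), h.symm⟩ - dot u (x - y)) ^ 2 else 0

/-- `μ` is a probability measure, and for all `t > t₀` the normalized squared tilt deviation in
`Λ` exceeds `t` with `μ`-probability at most `exp(-β |Λ| t)`. -/
def TiltBound {d : ℕ} (μ : Measure (GradField d)) (Λ : Finset (Site d)) (u : Fin d → ℝ)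
    (β t₀ : ℝ) : Prop :=
  IsProbabilityMeasure μ ∧
    ∀ t : ℝ, t₀ < t →
      μ {η | t < tiltDeviation Λ u η} ≤ ENNReal.ofReal (Real.exp (-(β * (Λ.card : ℝ) * t)))

/-! ### The assumptions on the disorder and on the potentials -/

/-- Model A: `V` is `C²` and even, `V(s) ≥ A s² - B` and `V'' ≤ C₂` with `A, C₂ > 0`, and the
fields `ξ(x)` are i.i.d. real random variables. -/
structure IsModelA {d : ℕ} {Ω : Type*} [MeasurableSpace Ω] (P : Measure Ω)
    (V : ℝ → ℝ) (A B C₂ : ℝ) (ξ : Site d → Ω → ℝ) : Prop where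
  contDiff : ContDiff ℝ 2 V
  even : ∀ s, V (-s) = V s
  A_pos : 0 < A
  C₂_pos : 0 < C₂
  lower : ∀ s, A * s ^ 2 - B ≤ V s
  second_deriv_le : ∀ s, iteratedDeriv 2 V s ≤ C₂
  measurable : ∀ x, Measurable (ξ x)
  indep : iIndepFun ξ P
  identDistrib : ∀ x y, IdentDistrib (ξ x) (ξ y) P P

/-- The random elements `f x y`, for bonds `(x, y)`, are i.i.d. over the bonds. Either the bonds
are directed, so that `f x y` and `f y x` are independent; or the bonds are undirected, so that
`f x y = f y x`, and the family is i.i.d. over the undirected bonds `{x, x + e_i}`. -/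
def IIDOverBonds {d : ℕ} {Ω E : Type*} [MeasurableSpace Ω] [MeasurableSpace E] (P : Measure Ω)
    (f : Site d → Site d → Ω → E) : Prop :=
  (iIndepFun (fun b : Bond d => f b.1.1 b.1.2) P ∧
      ∀ b c : Bond d, IdentDistrib (f b.1.1 b.1.2) (f c.1.1 c.1.2) P P) ∨
  ((∀ x y, Adj x y → f x y = f y x) ∧
    iIndepFun (fun p : Site d × Fin d => f p.1 (p.1 + Pi.single p.2 1)) P ∧
      ∀ p q : Site d × Fin d, IdentDistrib (f p.1 (p.1 + Pi.single p.2 1))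
        (f q.1 (q.1 + Pi.single q.2 1)) P P)

/-- Model B: i.i.d. random even `C²` potentials `V x y ω` on the bonds and i.i.d. integrable
random variables `B x y` on the bonds, such that almost surely
`A s² - B x y ω ≤ V x y ω s ≤ C₂ s²` for all bonds and all `s`, with `A, C₂ > 0`.
Independence and equality of laws of the random functions `V x y` refer to the product σ-algebra
of `ℝ → ℝ`. -/
structure IsModelB {d : ℕ} {Ω : Type*} [MeasurableSpace Ω] (P : Measure Ω)
    (V : Site d → Site d → Ω → ℝ → ℝ) (A C₂ : ℝ) (B : Site d → Site d → Ω → ℝ) : Prop where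
  measurable : ∀ x y, Adj x y → Measurable (fun p : Ω × ℝ => V x y p.1 p.2)
  iid_potential : IIDOverBonds P V
  contDiff : ∀ x y, Adj x y → ∀ ω, ContDiff ℝ 2 (V x y ω)
  even : ∀ x y, Adj x y → ∀ ω s, V x y ω (-s) = V x y ω s
  measurable_B : ∀ x y, Adj x y → Measurable (B x y)
  iid_B : IIDOverBonds P B
  integrable_B : ∀ x y, Adj x y → Integrable (B x y) P
  A_pos : 0 < A
  C₂_pos : 0 < C₂
  bounds : ∀ᵐ ω ∂P, ∀ x y, Adj x y → ∀ s,
    A * s ^ 2 - B x y ω ≤ V x y ω s ∧ V x y ω s ≤ C₂ * s ^ 2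

end Interface

end

/-! Write φ = ψ_u + h with h = 0 off Λ. The Dirichlet energy E(h) does not depend on the volume in
which it is computed, and it dominates |Λ_N| D_N even if Λ is a translate of Λ_N. So it suffices to
bound an exponential moment of E(h) by exp(K|Λ|) and to apply Chebyshev's inequality.

Up to errors of order |Λ| and field terms, the quadratic bounds on the potentials place the
Hamiltonian between multiples of E(h). The moment of exp(A E(h)/8) is thereby at most exp(const |Λ|)
times a ratio of two Gaussian partition functions, and scaling the heights shows that this ratio is
exactly (8C/A)^(|Λ|/2). In the partition function the linear field term is removed by the symmetry h
→ -h. In the numerator it is absorbed by ∑ ξ h ≤ (A/8) E(h) + κ|Λ|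
(`FiniteVolumeBounds.lintegral_exp_le_partitionFn`, `FiniteVolumeBounds.tiltBound`).

It remains to control the disorder simultaneously in all translates of Λ_N by its sites; these lie
in Λ_{2N}, whose volume is comparable. In model B this is the law of large numbers for |B|
(`exists_tendsto_bond_average`). In model A, completing the square reduces the field bound to ⟨ξ,
Gξ⟩ = O(|Λ|), with G the Green function of the box (`exists_green`, `exists_field_bound`). For d ≥ 3
the diagonal of G is bounded and the law of large numbers for ξ² applies. The off-diagonal part is
centred with variance of order at most ∑ G(x,y)² = O(|Λ| N²), so Borel-Cantelli works along dyadic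
boxes, and monotonicity in the volume covers the rest.

Both facts about G, the bounded diagonal and the column norms, come from the ground state bound
`sum_laplacian_le_energy`: a superharmonic function peaked at a point bounds h there by E(h), and a
parabola gives the Poincaré inequality. -/

namespace Interface

variable {d : ℕ}

/-! ### Nearest neighbours -/

/-- The nearest neighbours of a site. -/
def nbr (x : Site d) : Finset (Site d) :=
  (Finset.univ.image fun i : Fin d => x + Pi.single i 1) ∪
    Finset.univ.image fun i : Fin d => x - Pi.single i 1

theorem adj_comm {x y : Site d} : Adj x y ↔ Adj y x := ⟨Adj.symm, Adj.symm⟩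

theorem adj_add_single (x : Site d) (i : Fin d) : Adj x (x + Pi.single i 1) := by
  simp only [Adj, Pi.add_apply, sub_add_cancel_left, abs_neg]
  rw [Finset.sum_eq_single i]
  · simp
  · intro j _ hj
    simp [hj]
  · simp

theorem adj_sub_single (x : Site d) (i : Fin d) : Adj x (x - Pi.single i 1) := by
  have := (adj_add_single (x - Pi.single i 1) i).symm
  rwa [sub_add_cancel] at this

theorem adj_iff {x y : Site d} :
    Adj x y ↔ ∃ i, y = x + Pi.single i 1 ∨ y = x - Pi.single i 1 := by
  constructor
  · intro h
    have hne : ∃ i, x i - y i ≠ 0 := by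
      by_contra! hc
      simp [Adj, hc] at h
    obtain ⟨i, hi⟩ := hne
    have h1 : 1 ≤ |x i - y i| := Int.one_le_abs hi
    have h2 : |x i - y i| + ∑ j ∈ Finset.univ.erase i, |x j - y j| = 1 := by
      rw [Finset.add_sum_erase _ (fun j => |x j - y j|) (Finset.mem_univ i)]; exact h
    have h3 : 0 ≤ ∑ j ∈ Finset.univ.erase i, |x j - y j| :=
      Finset.sum_nonneg fun j _ => abs_nonneg _
    have h4 : ∑ j ∈ Finset.univ.erase i, |x j - y j| = 0 := by omega
    have h5 : |x i - y i| = 1 := by omega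
    rw [Finset.sum_eq_zero_iff_of_nonneg fun j _ => abs_nonneg _] at h4
    have h6 : ∀ j, j ≠ i → y j = x j := fun j hj => by
      have := h4 j (by simp [hj])
      rw [abs_eq_zero] at this
      omega
    refine ⟨i, ?_⟩
    rcases (abs_eq (zero_le_one)).1 h5 with h7 | h7
    · right
      funext j
      by_cases hj : j = i
      · subst hj; simp; omega
      · simp [hj, h6 j hj]
    · left
      funext j
      by_cases hj : j = i
      · subst hj; simp; omega
      · simp [hj, h6 j hj]
  · rintro ⟨i, rfl | rfl⟩
    · exact adj_add_single x i
    · exact adj_sub_single x i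

theorem mem_nbr {x y : Site d} : y ∈ nbr x ↔ Adj x y := by
  rw [adj_iff]
  simp only [nbr, Finset.mem_union, Finset.mem_image, Finset.mem_univ, true_and]
  constructor
  · rintro (⟨i, rfl⟩ | ⟨i, rfl⟩)
    · exact ⟨i, Or.inl rfl⟩
    · exact ⟨i, Or.inr rfl⟩
  · rintro ⟨i, rfl | rfl⟩
    · exact Or.inl ⟨i, rfl⟩
    · exact Or.inr ⟨i, rfl⟩

theorem sum_nbr (x : Site d) (F : Site d → ℝ) :
    ∑ y ∈ nbr x, F y = ∑ i, (F (x + Pi.single i 1) + F (x - Pi.single i 1)) := by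
  have hinj : Function.Injective fun i : Fin d => (Pi.single i 1 : Site d) := by
    intro i j h
    by_contra hne
    have := congrFun h i
    simp [hne] at this
  rw [nbr, Finset.sum_union, Finset.sum_image, Finset.sum_image, Finset.sum_add_distrib]
  · intro i _ j _ h
    exact hinj (sub_right_injective h)
  · intro i _ j _ h
    exact hinj (add_right_injective x h)
  · rw [Finset.disjoint_left]
    intro y h1 h2
    simp only [Finset.mem_image, Finset.mem_univ, true_and] at h1 h2
    obtain ⟨i, rfl⟩ := h1
    obtain ⟨j, h⟩ := h2
    have h' := congrFun h i
    by_cases hij : i = j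
    · subst hij; simp at h'; omega
    · simp [hij] at h'

theorem card_nbr_le (x : Site d) : ((nbr x).card : ℝ) ≤ 2 * d := by
  have h : (((nbr x).card : ℕ) : ℝ) = ∑ y ∈ nbr x, (1 : ℝ) := by simp
  rw [h, sum_nbr]
  simp
  linarith

/-! ### Sums over the bonds that touch a finite volume -/

/-- The sum over the bonds touching `Λ` that appears in the Hamiltonians. -/
noncomputable def bondSum (Λ : Finset (Site d)) (F : Site d → Site d → ℝ) : ℝ :=
  1 / 2 * (∑ x ∈ Λ, ∑ y ∈ Λ with Adj x y, F x y)
    + ∑ x ∈ Λ, ∑ y ∈ boundary Λ with Adj x y, F x y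

theorem mem_boundary_of_adj {Λ : Finset (Site d)} {x y : Site d} (hx : x ∈ Λ) (hy : y ∉ Λ)
    (h : Adj x y) : y ∈ boundary Λ :=
  (mem_boundary Λ y).2 ⟨hy, x, hx, h.symm⟩

theorem sum_inside_add_boundary {Λ : Finset (Site d)} {x : Site d} (hx : x ∈ Λ)
    (F : Site d → ℝ) :
    ∑ y ∈ Λ with Adj x y, F y + ∑ y ∈ boundary Λ with Adj x y, F y = ∑ y ∈ nbr x, F y := by
  rw [← Finset.sum_union]
  · refine Finset.sum_congr ?_ fun _ _ => rfl
    ext y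
    simp only [Finset.mem_union, Finset.mem_filter, mem_nbr]
    constructor
    · rintro (h | h) <;> exact h.2
    · intro h
      by_cases hy : y ∈ Λ
      · exact Or.inl ⟨hy, h⟩
      · exact Or.inr ⟨mem_boundary_of_adj hx hy h, h⟩
  · rw [Finset.disjoint_left]
    intro y h1 h2
    rw [Finset.mem_filter] at h1 h2
    exact ((mem_boundary Λ y).1 h2.1).1 h1.1

theorem bondSum_mono {Λ : Finset (Site d)} {F G : Site d → Site d → ℝ}
    (h : ∀ x ∈ Λ, ∀ y, Adj x y → F x y ≤ G x y) : bondSum Λ F ≤ bondSum Λ G := by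
  unfold bondSum
  gcongr with x hx y hy x hx y hy
  · exact h x hx y (Finset.mem_filter.1 hy).2
  · exact h x hx y (Finset.mem_filter.1 hy).2

theorem bondSum_congr {Λ : Finset (Site d)} {F G : Site d → Site d → ℝ}
    (h : ∀ x ∈ Λ, ∀ y, Adj x y → F x y = G x y) : bondSum Λ F = bondSum Λ G :=
  le_antisymm (bondSum_mono fun x hx y hy => (h x hx y hy).le)
    (bondSum_mono fun x hx y hy => (h x hx y hy).ge)

theorem bondSum_add (Λ : Finset (Site d)) (F G : Site d → Site d → ℝ) :
    bondSum Λ (fun x y => F x y + G x y) = bondSum Λ F + bondSum Λ G := by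
  simp only [bondSum, Finset.sum_add_distrib]
  ring

theorem bondSum_mul (Λ : Finset (Site d)) (c : ℝ) (F : Site d → Site d → ℝ) :
    bondSum Λ (fun x y => c * F x y) = c * bondSum Λ F := by
  simp only [bondSum, ← Finset.mul_sum]
  ring

theorem bondSum_le_sum_nbr {Λ : Finset (Site d)} {F : Site d → Site d → ℝ}
    (h : ∀ x ∈ Λ, ∀ y, Adj x y → 0 ≤ F x y) :
    bondSum Λ F ≤ ∑ x ∈ Λ, ∑ y ∈ nbr x, F x y := by
  have h1 : ∑ x ∈ Λ, ∑ y ∈ nbr x, F x y = ∑ x ∈ Λ, ∑ y ∈ Λ with Adj x y, F x y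
      + ∑ x ∈ Λ, ∑ y ∈ boundary Λ with Adj x y, F x y := by
    rw [← Finset.sum_add_distrib]
    exact Finset.sum_congr rfl fun x hx => (sum_inside_add_boundary hx _).symm
  have h2 : 0 ≤ ∑ x ∈ Λ, ∑ y ∈ Λ with Adj x y, F x y :=
    Finset.sum_nonneg fun x hx => Finset.sum_nonneg fun y hy => h x hx y (Finset.mem_filter.1 hy).2
  rw [h1, bondSum]
  linarith

theorem bondSum_const_le (Λ : Finset (Site d)) {c : ℝ} (hc : 0 ≤ c) :
    bondSum Λ (fun _ _ => c) ≤ 2 * d * c * Λ.card := by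
  refine (bondSum_le_sum_nbr fun _ _ _ _ => hc).trans ?_
  calc ∑ x ∈ Λ, ∑ y ∈ nbr x, c ≤ ∑ x ∈ Λ, 2 * d * c := by
        gcongr with x _
        rw [Finset.sum_const, nsmul_eq_mul]
        exact mul_le_mul_of_nonneg_right (card_nbr_le x) hc
    _ = _ := by rw [Finset.sum_const, nsmul_eq_mul]; ring

/-! ### The Dirichlet energy -/

/-- The Dirichlet energy over the bonds touching `Λ`. -/
noncomputable def energy (Λ : Finset (Site d)) (h : Site d → ℝ) : ℝ :=
  bondSum Λ fun x y => (h x - h y) ^ 2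

theorem bondSum_nonneg {Λ : Finset (Site d)} {F : Site d → Site d → ℝ}
    (h : ∀ x ∈ Λ, ∀ y, Adj x y → 0 ≤ F x y) : 0 ≤ bondSum Λ F := by
  have := bondSum_mono (F := fun _ _ => (0 : ℝ)) h
  simpa [bondSum] using this

theorem energy_nonneg (Λ : Finset (Site d)) (h : Site d → ℝ) : 0 ≤ energy Λ h :=
  bondSum_nonneg fun _ _ _ _ => sq_nonneg _

/-- Pairs outside Λ contribute nothing, and a pair with one site in Λ occurs in both orders on the
right, which cancels the factor 1/2. -/
theorem energy_eq_of_subset {Λ M : Finset (Site d)} {h : Site d → ℝ} (hh : ∀ x ∉ Λ, h x = 0)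
    (hM : Λ ∪ boundary Λ ⊆ M) :
    energy Λ h = 1 / 2 * ∑ x ∈ M, ∑ y ∈ M with Adj x y, (h x - h y) ^ 2 := by
  have hΛ : Λ ⊆ M := Finset.subset_union_left.trans hM
  simp only [Finset.sum_filter]
  have e1 : ∀ f : Site d → ℝ, ∑ x ∈ M, f x = ∑ x ∈ M \ Λ, f x + ∑ x ∈ Λ, f x := fun f =>
    (Finset.sum_sdiff hΛ).symm
  have e2 : ∑ x ∈ M \ Λ, ∑ y ∈ M \ Λ, (if Adj x y then (h x - h y) ^ 2 else 0) = 0 := by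
    refine Finset.sum_eq_zero fun x hx => Finset.sum_eq_zero fun y hy => ?_
    rw [hh x (Finset.mem_sdiff.1 hx).2, hh y (Finset.mem_sdiff.1 hy).2]
    simp
  have e3 : ∑ x ∈ M \ Λ, ∑ y ∈ Λ, (if Adj x y then (h x - h y) ^ 2 else 0) =
      ∑ x ∈ Λ, ∑ y ∈ M \ Λ, (if Adj x y then (h x - h y) ^ 2 else 0) := by
    rw [Finset.sum_comm]
    refine Finset.sum_congr rfl fun x _ => Finset.sum_congr rfl fun y _ => ?_
    exact if_congr adj_comm (by ring) rfl
  have e4 : ∀ x ∈ Λ, ∑ y ∈ M \ Λ, (if Adj x y then (h x - h y) ^ 2 else 0) =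
      ∑ y ∈ boundary Λ, (if Adj x y then (h x - h y) ^ 2 else 0) := by
    intro x hx
    symm
    refine Finset.sum_subset ?_ ?_
    · intro y hy
      exact Finset.mem_sdiff.2 ⟨hM (Finset.mem_union_right _ hy), ((mem_boundary Λ y).1 hy).1⟩
    · intro y hy hy'
      rw [if_neg]
      intro hadj
      exact hy' (mem_boundary_of_adj hx (Finset.mem_sdiff.1 hy).2 hadj)
  simp only [e1, Finset.sum_add_distrib]
  rw [e2, e3, Finset.sum_congr rfl e4, energy, bondSum]
  simp only [Finset.sum_filter]
  ring

theorem energy_eq_of_le {Λ Λ' : Finset (Site d)} {h : Site d → ℝ} (hh : ∀ x ∉ Λ, h x = 0)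
    (hΛ : Λ ⊆ Λ') : energy Λ h = energy Λ' h := by
  rw [energy_eq_of_subset hh (M := (Λ ∪ boundary Λ) ∪ (Λ' ∪ boundary Λ'))
    Finset.subset_union_left, energy_eq_of_subset (Λ := Λ') (fun x hx => hh x fun hx' => hx (hΛ hx'))
    Finset.subset_union_right]

/-- No relation between Λ₀ and Λ is required: the deviation is measured in Λ_N while the Gibbs
measure may live in a translate. -/
theorem half_sum_le_energy {Λ : Finset (Site d)} {h : Site d → ℝ} (hh : ∀ x ∉ Λ, h x = 0)
    (Λ₀ : Finset (Site d)) :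
    1 / 2 * ∑ x ∈ Λ₀, ∑ y ∈ Λ₀ with Adj x y, (h x - h y) ^ 2 ≤ energy Λ h := by
  rw [energy_eq_of_subset hh (M := (Λ ∪ boundary Λ) ∪ Λ₀) Finset.subset_union_left]
  have hs : Λ₀ ⊆ (Λ ∪ boundary Λ) ∪ Λ₀ := Finset.subset_union_right
  gcongr
  calc ∑ x ∈ Λ₀, ∑ y ∈ Λ₀ with Adj x y, (h x - h y) ^ 2
      ≤ ∑ x ∈ Λ₀, ∑ y ∈ (Λ ∪ boundary Λ) ∪ Λ₀ with Adj x y, (h x - h y) ^ 2 :=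
        Finset.sum_le_sum fun x _ => Finset.sum_le_sum_of_subset_of_nonneg
          (Finset.filter_subset_filter _ hs) fun _ _ _ => sq_nonneg _
    _ ≤ _ := Finset.sum_le_sum_of_subset_of_nonneg hs fun _ _ _ =>
        Finset.sum_nonneg fun _ _ => sq_nonneg _

theorem energy_smul (Λ : Finset (Site d)) (c : ℝ) (h : Site d → ℝ) :
    energy Λ (fun x => c * h x) = c ^ 2 * energy Λ h := by
  rw [energy, energy, ← bondSum_mul]
  exact bondSum_congr fun _ _ _ _ => by ring

/-- The ground state bound: a positive function `g` bounds the Dirichlet energy from below by the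
potential `-Δg / g`. -/
theorem sum_laplacian_le_energy {Λ : Finset (Site d)} {h g : Site d → ℝ}
    (hh : ∀ x ∉ Λ, h x = 0) (hg : ∀ x ∈ Λ, 0 < g x) (hg' : ∀ x ∈ boundary Λ, 0 ≤ g x) :
    ∑ x ∈ Λ, h x ^ 2 / g x * ∑ y ∈ nbr x, (g x - g y) ≤ energy Λ h := by
  have e1 : ∑ x ∈ Λ, h x ^ 2 / g x * ∑ y ∈ nbr x, (g x - g y) =
      ∑ x ∈ Λ, ∑ y ∈ Λ with Adj x y, h x ^ 2 / g x * (g x - g y) +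
      ∑ x ∈ Λ, ∑ y ∈ boundary Λ with Adj x y, h x ^ 2 / g x * (g x - g y) := by
    rw [← Finset.sum_add_distrib]
    refine Finset.sum_congr rfl fun x hx => ?_
    rw [← sum_inside_add_boundary hx, mul_add, Finset.mul_sum, Finset.mul_sum]
  have e2 : ∑ x ∈ Λ, ∑ y ∈ Λ with Adj x y, h x ^ 2 / g x * (g x - g y) =
      ∑ x ∈ Λ, ∑ y ∈ Λ with Adj x y, h y ^ 2 / g y * (g y - g x) := by
    simp only [Finset.sum_filter]
    rw [Finset.sum_comm]
    refine Finset.sum_congr rfl fun x _ => Finset.sum_congr rfl fun y _ => ?_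
    exact if_congr adj_comm rfl rfl
  -- Symmetrising in x and y allows a comparison with the energy bond by bond.
  have e3 : ∑ x ∈ Λ, ∑ y ∈ Λ with Adj x y, h x ^ 2 / g x * (g x - g y) =
      1 / 2 * ∑ x ∈ Λ, ∑ y ∈ Λ with Adj x y,
        (h x ^ 2 / g x * (g x - g y) + h y ^ 2 / g y * (g y - g x)) := by
    simp only [Finset.sum_add_distrib]
    rw [← e2]
    ring
  rw [e1, e3, energy, bondSum]
  gcongr with x hx y hy x hx y hy
  · have h1 := hg x hx
    have h2 := hg y (Finset.mem_filter.1 hy).1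
    -- Picone's identity: the difference is a square divided by a product of positive values of g.
    have : (h x - h y) ^ 2 - (h x ^ 2 / g x * (g x - g y) + h y ^ 2 / g y * (g y - g x))
        = (h x * g y - h y * g x) ^ 2 / (g x * g y) := by
      field_simp
      ring
    have h3 : 0 ≤ (h x * g y - h y * g x) ^ 2 / (g x * g y) := by positivity
    linarith
  · have h1 := hg x hx
    have hy' := (Finset.mem_filter.1 hy).1
    have h2 := hg' y hy'
    rw [hh y ((mem_boundary Λ y).1 hy').1]
    have : (h x - 0) ^ 2 - h x ^ 2 / g x * (g x - g y) = h x ^ 2 / g x * g y := by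
      field_simp
      ring
    have h3 : 0 ≤ h x ^ 2 / g x * g y := by positivity
    linarith

theorem abs_sub_le_one_of_adj {x y : Site d} (h : Adj x y) (i : Fin d) : |x i - y i| ≤ 1 := by
  have := Finset.single_le_sum (f := fun i => |x i - y i|)
    (fun i _ => abs_nonneg _) (Finset.mem_univ i)
  exact this.trans (le_of_eq h)

/-- The Poincaré inequality in a slab of width of order `M`. -/
theorem poincare {Λ : Finset (Site d)} {h : Site d → ℝ} (hh : ∀ x ∉ Λ, h x = 0) (i : Fin d)
    (M : ℕ) (hM : ∀ x ∈ Λ, |x i| ≤ M) :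
    ∑ x ∈ Λ, h x ^ 2 ≤ 2 * ((M : ℝ) + 1) ^ 2 * energy Λ h := by
  -- This parabola has -Δg = 2, is positive on Λ and nonnegative one step further out, and is at
  -- most 2(M+1)².
  set g : Site d → ℝ := fun x => 2 * ((M : ℝ) + 1) ^ 2 - (x i : ℝ) ^ 2 with hgdef
  have hx1 : ∀ x ∈ Λ, (x i : ℝ) ^ 2 ≤ (M : ℝ) ^ 2 := fun x hx => by
    have : |(x i : ℝ)| ≤ (M : ℝ) := by exact_mod_cast hM x hx
    exact sq_le_sq' (by linarith [abs_le.1 this]) (abs_le.1 this).2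
  have hM0 : (0 : ℝ) ≤ M := Nat.cast_nonneg M
  have hg : ∀ x ∈ Λ, 0 < g x := fun x hx => by
    have := hx1 x hx
    simp only [hgdef]
    nlinarith
  have hg' : ∀ x ∈ boundary Λ, 0 ≤ g x := fun x hx => by
    obtain ⟨-, y, hy, hxy⟩ := (mem_boundary Λ x).1 hx
    have h1 := abs_sub_le_one_of_adj hxy i
    have h2 := hM y hy
    have h3 : |x i| ≤ M + 1 := by
      rw [abs_le] at *
      constructor <;> omega
    have h4 : |(x i : ℝ)| ≤ (M : ℝ) + 1 := by exact_mod_cast h3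
    have h5 : (x i : ℝ) ^ 2 ≤ ((M : ℝ) + 1) ^ 2 :=
      sq_le_sq' (by linarith [abs_le.1 h4]) (abs_le.1 h4).2
    simp only [hgdef]
    nlinarith
  have hlap : ∀ x, ∑ y ∈ nbr x, (g x - g y) = 2 := fun x => by
    rw [sum_nbr, Finset.sum_eq_single i]
    · simp [hgdef]
      ring
    · intro j _ hj
      simp [hgdef, hj.symm]
    · simp
  have key := sum_laplacian_le_energy hh hg hg'
  simp only [hlap] at key
  calc ∑ x ∈ Λ, h x ^ 2 ≤ ∑ x ∈ Λ, 2 * ((M : ℝ) + 1) ^ 2 * (h x ^ 2 / g x * 2) := by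
        gcongr with x hx
        have h1 := hg x hx
        have h2 : g x ≤ 2 * ((M : ℝ) + 1) ^ 2 := by
          simp only [hgdef]
          nlinarith [sq_nonneg (x i : ℝ)]
        have h3 : h x ^ 2 = g x * (h x ^ 2 / g x) := by field_simp
        have h4 : 0 ≤ h x ^ 2 / g x := by positivity
        nlinarith
    _ = 2 * ((M : ℝ) + 1) ^ 2 * ∑ x ∈ Λ, h x ^ 2 / g x * 2 := by rw [Finset.mul_sum]
    _ ≤ _ := by gcongr

/-! ### A superharmonic function in dimension at least three -/

/-- The function `s ↦ s^(-1/4)`. -/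
noncomputable def invQuarter (s : ℝ) : ℝ := (√√s)⁻¹

theorem invQuarter_pos {s : ℝ} (hs : 0 < s) : 0 < invQuarter s := by
  unfold invQuarter; positivity

theorem invQuarter_pow {s : ℝ} (hs : 0 < s) : invQuarter s ^ 4 * s = 1 := by
  have h1 : √√s ^ 4 = s := by
    rw [show √√s ^ 4 = (√√s ^ 2) ^ 2 by ring, Real.sq_sqrt (Real.sqrt_nonneg s), Real.sq_sqrt hs.le]
  rw [invQuarter, inv_pow, h1, inv_mul_cancel₀ hs.ne']

theorem invQuarter_mul {s t : ℝ} (hs : 0 ≤ s) :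
    invQuarter (s * t) = invQuarter s * invQuarter t := by
  rw [invQuarter, Real.sqrt_mul hs, Real.sqrt_mul (Real.sqrt_nonneg s), mul_inv]
  rfl

/-- Taking fourth powers turns estimates of s^(-1/4) into polynomial inequalities. -/
theorem invQuarter_le {s q : ℝ} (hs : 0 < s) (hq : 0 ≤ q) (h : 1 ≤ q ^ 4 * s) :
    invQuarter s ≤ q := by
  have h1 := invQuarter_pow hs
  refine le_of_pow_le_pow_left₀ (n := 4) (by norm_num) hq ?_
  by_contra! hlt
  nlinarith

theorem le_invQuarter {s q : ℝ} (hs : 0 < s) (h : q ^ 4 * s ≤ 1) : q ≤ invQuarter s := by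
  have h1 := invQuarter_pow hs
  refine le_of_pow_le_pow_left₀ (n := 4) (by norm_num) (invQuarter_pos hs).le ?_
  by_contra! hlt
  nlinarith

/-- The Taylor coefficient of z² is 5/32; the excess of 3/16 over it absorbs the remainder for |z| ≤
1/16. -/
theorem invQuarter_one_add_le {z : ℝ} (hz : |z| ≤ 1 / 16) :
    invQuarter (1 + z) ≤ 1 - z / 4 + 3 / 16 * z ^ 2 := by
  obtain ⟨h1, h2⟩ := abs_le.1 hz
  refine invQuarter_le (by linarith) (by nlinarith) ?_
  set q := 1 - z / 4 + 3 / 16 * z ^ 2 with hq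
  have hz2 : z ^ 2 ≤ 1 / 256 := by nlinarith
  -- An intermediate bound for (1+z)^(-1/2): 13/32 lies between the Taylor coefficient 12/32 and the
  -- coefficient 14/32 of q², so two squarings replace a fourth power.
  set r := 1 - z / 2 + 13 / 32 * z ^ 2 with hr
  have hr0 : 0 ≤ r := by nlinarith
  have hqr : r ≤ q ^ 2 := by
    have : q ^ 2 - r = z ^ 2 * (1 / 32 - 3 / 32 * z + 9 / 256 * z ^ 2) := by
      rw [hq, hr]; ring
    have h3 : 0 ≤ z ^ 2 * (1 / 32 - 3 / 32 * z + 9 / 256 * z ^ 2) :=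
      mul_nonneg (sq_nonneg z) (by nlinarith)
    linarith
  have hr2 : 1 ≤ r ^ 2 * (1 + z) := by
    have : r ^ 2 * (1 + z) - 1 =
        z ^ 2 * (1 / 16 + 21 / 32 * z - 247 / 1024 * z ^ 2 + 169 / 1024 * z ^ 2 * z) := by
      rw [hr]; ring
    have h3 : 0 ≤ z ^ 2 * (1 / 16 + 21 / 32 * z - 247 / 1024 * z ^ 2 + 169 / 1024 * z ^ 2 * z) :=
      mul_nonneg (sq_nonneg z) (by nlinarith [sq_nonneg z])
    linarith
  have h4 : r ^ 2 ≤ q ^ 4 := by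
    rw [show q ^ 4 = (q ^ 2) ^ 2 by ring]
    exact pow_le_pow_left₀ hr0 hqr 2
  nlinarith

theorem le_invQuarter_one_sub {w : ℝ} (h0 : 0 ≤ w) (h1 : w < 1) :
    1 + w / 4 ≤ invQuarter (1 - w) := by
  refine le_invQuarter (by linarith) ?_
  have h2 : (1 + w / 4) ^ 4 ≤ Real.exp w := by
    calc (1 + w / 4) ^ 4 ≤ Real.exp (w / 4) ^ 4 := by
          gcongr
          linarith [Real.add_one_le_exp (w / 4)]
      _ = Real.exp w := by rw [← Real.exp_nat_mul]; congr 1; push_cast; ring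
  have h3 : 1 - w ≤ Real.exp (-w) := by linarith [Real.add_one_le_exp (-w)]
  calc (1 + w / 4) ^ 4 * (1 - w) ≤ Real.exp w * Real.exp (-w) := by
        gcongr
    _ = 1 := by rw [← Real.exp_add]; simp

/-- The squared Euclidean length of a site. -/
noncomputable def sqNorm (x : Site d) : ℝ := ∑ i, (x i : ℝ) ^ 2

theorem sqNorm_nonneg (x : Site d) : 0 ≤ sqNorm x := Finset.sum_nonneg fun _ _ => sq_nonneg _

theorem sqNorm_add_single (x : Site d) (i : Fin d) (c : ℤ) :
    sqNorm (x + Pi.single i c) = sqNorm x + 2 * c * x i + (c : ℝ) ^ 2 := by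
  unfold sqNorm
  have : ∀ j, (((x + Pi.single i c : Site d) j : ℤ) : ℝ) ^ 2 =
      (x j : ℝ) ^ 2 + if j = i then 2 * c * x i + (c : ℝ) ^ 2 else 0 := fun j => by
    by_cases hj : j = i
    · subst hj
      simp
      ring
    · simp [hj]
  rw [Finset.sum_congr rfl fun j _ => this j, Finset.sum_add_distrib, Finset.sum_ite_eq',
    if_pos (Finset.mem_univ i)]
  ring

/-- The function `x ↦ (256 + |x|²)^(-1/4)`. -/
noncomputable def barrier (x : Site d) : ℝ := invQuarter (256 + sqNorm x)

theorem barrier_pos (x : Site d) : 0 < barrier x :=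
  invQuarter_pos (by linarith [sqNorm_nonneg x])

theorem barrier_le_one (x : Site d) : barrier x ≤ 1 :=
  invQuarter_le (by linarith [sqNorm_nonneg x]) zero_le_one (by linarith [sqNorm_nonneg x])

theorem sum_barrier_neighbours_le (x : Site d) (i : Fin d) :
    barrier (x + Pi.single i 1) + barrier (x - Pi.single i 1) ≤
      invQuarter (257 + sqNorm x) * (2 + 3 / 2 * (x i : ℝ) ^ 2 / (257 + sqNorm x) ^ 2) := by
  set m := 257 + sqNorm x with hm
  have hn := sqNorm_nonneg x
  have hm0 : 0 < m := by linarith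
  have hxi : (x i : ℝ) ^ 2 ≤ sqNorm x :=
    Finset.single_le_sum (f := fun i => (x i : ℝ) ^ 2) (fun _ _ => sq_nonneg _) (Finset.mem_univ i)
  set z := 2 * (x i : ℝ) / m with hz
  -- This follows from 32|x_i| ≤ 256 + x_i², that is (|x_i| - 16)² ≥ 0, which accounts for the
  -- constant 256 in `barrier`.
  have hz16 : |z| ≤ 1 / 16 := by
    rw [hz, abs_div, abs_of_pos hm0, div_le_iff₀ hm0, abs_mul, abs_two]
    nlinarith [sq_nonneg (|(x i : ℝ)| - 16), sq_abs (x i : ℝ)]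
  have e1 : barrier (x + Pi.single i 1) = invQuarter m * invQuarter (1 + z) := by
    rw [← invQuarter_mul hm0.le, barrier, sqNorm_add_single, hz]
    congr 1
    field_simp
    rw [hm]
    push_cast
    ring
  have e2 : barrier (x - Pi.single i 1) = invQuarter m * invQuarter (1 + -z) := by
    rw [← invQuarter_mul hm0.le, barrier, sub_eq_add_neg, ← Pi.single_neg,
      sqNorm_add_single, hz]
    congr 1
    field_simp
    rw [hm]
    push_cast
    ring
  have h1 := invQuarter_one_add_le hz16
  have h2 := invQuarter_one_add_le (z := -z) (by rwa [abs_neg])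
  have e3 : 3 / 2 * (x i : ℝ) ^ 2 / m ^ 2 = 3 / 8 * z ^ 2 := by
    rw [hz]
    field_simp
    ring
  rw [e1, e2, ← mul_add, e3]
  refine mul_le_mul_of_nonneg_left ?_ (invQuarter_pos hm0).le
  linarith

/-- With m = 257 + |x|², the neighbours sum to at most m^(-1/4)(2d + 3/(2m)), while 2d times the
central value is at least m^(-1/4)(2d + d/(2m)). The comparison 3/2 ≤ d/2 is where d ≥ 3 enters. -/
theorem laplacian_barrier (hd : 3 ≤ d) (x : Site d) :
    0 ≤ ∑ y ∈ nbr x, (barrier x - barrier y) := by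
  set m := 257 + sqNorm x with hm
  have hn := sqNorm_nonneg x
  have hm0 : 0 < m := by linarith
  have hd' : (3 : ℝ) ≤ d := by exact_mod_cast hd
  have h1 : ∑ i : Fin d, (barrier (x + Pi.single i 1) + barrier (x - Pi.single i 1)) ≤
      invQuarter m * (2 * d + 3 / 2 / m) := by
    calc _ ≤ ∑ i : Fin d, invQuarter m * (2 + 3 / 2 * (x i : ℝ) ^ 2 / m ^ 2) :=
          Finset.sum_le_sum fun i _ => sum_barrier_neighbours_le x i
      _ = invQuarter m * (2 * d + 3 / 2 * sqNorm x / m ^ 2) := by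
          rw [← Finset.mul_sum, Finset.sum_add_distrib, ← Finset.sum_div, ← Finset.mul_sum]
          simp [sqNorm, mul_comm]
      _ ≤ _ := by
          refine mul_le_mul_of_nonneg_left ?_ (invQuarter_pos hm0).le
          gcongr 2 * (d : ℝ) + ?_
          rw [div_le_div_iff₀ (by positivity) hm0]
          nlinarith
  have h2 : invQuarter m * (1 + 1 / m / 4) ≤ barrier x := by
    have : barrier x = invQuarter m * invQuarter (1 - 1 / m) := by
      rw [← invQuarter_mul hm0.le, barrier]
      congr 1
      field_simp
      rw [hm]
      ring
    rw [this]
    refine mul_le_mul_of_nonneg_left (le_invQuarter_one_sub (by positivity) ?_)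
      (invQuarter_pos hm0).le
    rw [div_lt_one hm0]
    linarith
  have h3 : invQuarter m * (2 * d + 3 / 2 / m) ≤ 2 * d * barrier x := by
    have : invQuarter m * (2 * d + 3 / 2 / m) ≤ 2 * d * (invQuarter m * (1 + 1 / m / 4)) := by
      have e : 2 * d * (invQuarter m * (1 + 1 / m / 4)) =
          invQuarter m * (2 * d + d / 2 / m) := by ring
      rw [e]
      refine mul_le_mul_of_nonneg_left ?_ (invQuarter_pos hm0).le
      gcongr
    have h4 : 2 * d * (invQuarter m * (1 + 1 / m / 4)) ≤ 2 * d * barrier x := by gcongr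
    linarith
  rw [sum_nbr]
  have e : ∑ i : Fin d, (barrier x - barrier (x + Pi.single i 1) +
      (barrier x - barrier (x - Pi.single i 1))) =
      2 * d * barrier x - ∑ i : Fin d, (barrier (x + Pi.single i 1) + barrier (x - Pi.single i 1)) := by
    rw [show 2 * d * barrier x = ∑ i : Fin d, 2 * barrier x by simp; ring, ← Finset.sum_sub_distrib]
    exact Finset.sum_congr rfl fun i _ => by ring
  rw [e]
  linarith

theorem exists_laplacian_barrier_zero (hd : 3 ≤ d) :
    ∃ c : ℝ, 0 < c ∧ c ≤ ∑ y ∈ nbr (0 : Site d), (barrier (0 : Site d) - barrier y) := by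
  have hlt : invQuarter 257 < invQuarter 256 := by
    unfold invQuarter
    have h1 : √(256 : ℝ) < √257 := Real.sqrt_lt_sqrt (by norm_num) (by norm_num)
    have h2 : √√(256 : ℝ) < √√257 := Real.sqrt_lt_sqrt (Real.sqrt_nonneg _) h1
    have h3 : 0 < √√(256 : ℝ) := by positivity
    exact inv_strictAnti₀ h3 h2
  refine ⟨∑ i : Fin d, 2 * (invQuarter 256 - invQuarter 257), ?_, ?_⟩
  · simp only [Finset.sum_const, Finset.card_univ, Fintype.card_fin, nsmul_eq_mul]
    have : (3 : ℝ) ≤ d := by exact_mod_cast hd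
    have : 0 < invQuarter 256 - invQuarter 257 := sub_pos.2 hlt
    positivity
  · rw [sum_nbr]
    refine Finset.sum_le_sum fun i _ => ?_
    have e1 : barrier (0 + Pi.single i 1 : Site d) = invQuarter 257 := by
      rw [barrier, sqNorm_add_single]
      congr 1
      simp [sqNorm]
      norm_num
    have e2 : barrier (0 - Pi.single i 1 : Site d) = invQuarter 257 := by
      rw [barrier, sub_eq_add_neg, ← Pi.single_neg, sqNorm_add_single]
      congr 1
      simp [sqNorm]
      norm_num
    have e3 : barrier (0 : Site d) = invQuarter 256 := by
      simp [barrier, sqNorm]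
    rw [e1, e2, e3]
    linarith

theorem sum_nbr_sub (x z : Site d) (F : Site d → ℝ) :
    ∑ y ∈ nbr x, F (y - z) = ∑ y ∈ nbr (x - z), F y := by
  simp only [sum_nbr]
  refine Finset.sum_congr rfl fun i _ => ?_
  congr 2 <;> abel

/-- In dimension at least three, point values are bounded by the Dirichlet energy. -/
theorem exists_sq_le_energy (hd : 3 ≤ d) :
    ∃ C : ℝ, 0 < C ∧ ∀ (Λ : Finset (Site d)) (h : Site d → ℝ), (∀ x ∉ Λ, h x = 0) →
      ∀ x, h x ^ 2 ≤ C * energy Λ h := by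
  obtain ⟨c, hc, hc'⟩ := exists_laplacian_barrier_zero hd
  refine ⟨1 / c, by positivity, fun Λ h hh z => ?_⟩
  by_cases hz : z ∈ Λ
  swap
  · rw [hh z hz]
    have := energy_nonneg Λ h
    rw [zero_pow two_ne_zero]
    positivity
  -- With the barrier centred at z all terms are nonnegative; only the term at z is kept, where -Δ
  -- of the barrier is at least c.
  have key := sum_laplacian_le_energy (Λ := Λ) (g := fun x => barrier (x - z)) hh
    (fun x _ => barrier_pos _) (fun x _ => (barrier_pos _).le)
  have hlap : ∀ x, ∑ y ∈ nbr x, (barrier (x - z) - barrier (y - z)) =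
      ∑ y ∈ nbr (x - z), (barrier (x - z) - barrier y) := fun x =>
    sum_nbr_sub x z fun y => barrier (x - z) - barrier y
  simp only [hlap] at key
  have h1 := Finset.single_le_sum (f := fun x => h x ^ 2 / barrier (x - z) *
      ∑ y ∈ nbr (x - z), (barrier (x - z) - barrier y)) (fun x _ =>
    mul_nonneg (div_nonneg (sq_nonneg _) (barrier_pos _).le) (laplacian_barrier hd _)) hz
  have h2 := h1.trans key
  simp only [sub_self] at h2
  have h3 : h z ^ 2 ≤ h z ^ 2 / barrier (0 : Site d) := by
    rw [le_div_iff₀ (barrier_pos _)]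
    nlinarith [sq_nonneg (h z), barrier_le_one (0 : Site d)]
  have h4 : h z ^ 2 * c ≤ h z ^ 2 / barrier (0 : Site d) *
      ∑ y ∈ nbr (0 : Site d), (barrier (0 : Site d) - barrier y) := by
    refine mul_le_mul h3 hc' hc.le (div_nonneg (sq_nonneg _) (barrier_pos _).le)
  rw [div_mul_eq_mul_div, one_mul, le_div_iff₀ hc]
  linarith

/-! ### Gaussian integrals over a finite volume -/

/-- The exponential of a real number as an extended nonnegative real. -/
noncomputable def eexp (r : ℝ) : ℝ≥0∞ := ENNReal.ofReal (Real.exp r)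

theorem eexp_add (r s : ℝ) : eexp (r + s) = eexp r * eexp s := by
  rw [eexp, Real.exp_add, ENNReal.ofReal_mul (Real.exp_pos _).le]
  rfl

theorem eexp_ne_zero (r : ℝ) : eexp r ≠ 0 := by
  simp [eexp, Real.exp_pos]

theorem eexp_ne_top (r : ℝ) : eexp r ≠ ⊤ := ENNReal.ofReal_ne_top

theorem eexp_le {r s : ℝ} (h : r ≤ s) : eexp r ≤ eexp s :=
  ENNReal.ofReal_le_ofReal (Real.exp_le_exp.2 h)

theorem measurable_eexp : Measurable eexp := by unfold eexp; fun_prop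

theorem glue_of_notMem {Λ : Finset (Site d)} {ψ : Site d → ℝ} {φ : Λ → ℝ} {x : Site d}
    (h : x ∉ Λ) : glue Λ ψ φ x = ψ x := by simp [glue, h]

theorem glue_coe {Λ : Finset (Site d)} {ψ : Site d → ℝ} {φ : Λ → ℝ} (x : Λ) :
    glue Λ ψ φ x = φ x := by simp [glue]

theorem glue_eq_add (Λ : Finset (Site d)) (ψ : Site d → ℝ) (φ : Λ → ℝ) :
    glue Λ ψ (φ + fun x : Λ => ψ x) = fun x => ψ x + glue Λ 0 φ x := by
  funext x
  by_cases h : x ∈ Λ <;> simp [glue, h, add_comm]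

theorem glue_smul (Λ : Finset (Site d)) (r : ℝ) (φ : Λ → ℝ) :
    glue Λ 0 (r • φ) = fun x => r * glue Λ 0 φ x := by
  funext x
  by_cases h : x ∈ Λ <;> simp [glue, h]

theorem glue_neg (Λ : Finset (Site d)) (φ : Λ → ℝ) :
    glue Λ 0 (-φ) = fun x => -glue Λ 0 φ x := by
  funext x
  by_cases h : x ∈ Λ <;> simp [glue, h]

theorem measurable_bondSum {α : Type*} [MeasurableSpace α] {Λ : Finset (Site d)}
    {F : Site d → Site d → α → ℝ} (hF : ∀ x y, Adj x y → Measurable (F x y)) :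
    Measurable fun a => bondSum Λ fun x y => F x y a := by
  unfold bondSum
  refine ((Finset.measurable_sum _ fun x _ => Finset.measurable_sum _ fun y hy => ?_).const_mul
    _).add (Finset.measurable_sum _ fun x _ => Finset.measurable_sum _ fun y hy => ?_)
  · exact hF x y (Finset.mem_filter.1 hy).2
  · exact hF x y (Finset.mem_filter.1 hy).2

theorem measurable_energy (Λ : Finset (Site d)) : Measurable (energy Λ) := by
  refine measurable_bondSum fun x y _ => ?_
  exact ((measurable_pi_apply x).sub (measurable_pi_apply y)).pow_const 2

/-- The Gaussian partition function with zero boundary condition. -/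
noncomputable def gaussZ (Λ : Finset (Site d)) (c : ℝ) : ℝ≥0∞ :=
  ∫⁻ φ : Λ → ℝ, eexp (-(c * energy Λ (glue Λ 0 φ)))

theorem measurable_gauss (Λ : Finset (Site d)) (c : ℝ) :
    Measurable fun φ : Λ → ℝ => eexp (-(c * energy Λ (glue Λ 0 φ))) :=
  measurable_eexp.comp (((measurable_energy Λ).comp (measurable_glue Λ 0)).const_mul c).neg

/-- The substitution φ = rφ' in a quadratic energy compares Gaussian partition functions exactly,
without determinants. -/
theorem gaussZ_scale (Λ : Finset (Site d)) (c : ℝ) {r : ℝ} (hr : 0 < r) :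
    gaussZ Λ c = ENNReal.ofReal (r ^ Λ.card) * gaussZ Λ (c * r ^ 2) := by
  have h1 : ∫⁻ φ : Λ → ℝ, eexp (-(c * energy Λ (glue Λ 0 φ)))
      ∂(Measure.map (fun x => r • x) volume) = gaussZ Λ (c * r ^ 2) := by
    rw [lintegral_map (measurable_gauss Λ c) (measurable_const_smul r), gaussZ]
    refine lintegral_congr fun φ => ?_
    rw [glue_smul, energy_smul, mul_assoc]
  rw [Measure.map_addHaar_smul _ hr.ne', lintegral_smul_measure] at h1
  rw [← h1, smul_eq_mul, ← mul_assoc, ← ENNReal.ofReal_mul (by positivity), gaussZ]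
  have hpos : 0 < r ^ Λ.card := by positivity
  have : r ^ Λ.card * |(r ^ Module.finrank ℝ (Λ → ℝ))⁻¹| = 1 := by
    rw [Module.finrank_fintype_fun_eq_card, Fintype.card_coe, abs_of_pos (by positivity),
      mul_inv_cancel₀ hpos.ne']
  rw [this]
  simp

theorem sum_glue {Λ : Finset (Site d)} {ψ : Site d → ℝ} (φ : Λ → ℝ) (F : ℝ → ℝ) :
    ∑ x ∈ Λ, F (glue Λ ψ φ x) = ∑ x : Λ, F (φ x) := by
  rw [← Finset.sum_coe_sort]
  exact Finset.sum_congr rfl fun x _ => by rw [glue_coe]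

theorem exists_poincare (Λ : Finset (Site d)) (hd : 1 ≤ d) :
    ∃ K : ℝ, 0 < K ∧ ∀ h : Site d → ℝ, (∀ x ∉ Λ, h x = 0) →
      ∑ x ∈ Λ, h x ^ 2 ≤ K * energy Λ h := by
  have hbdd : ∃ M : ℕ, ∀ x ∈ Λ, |x ⟨0, hd⟩| ≤ (M : ℤ) := by
    refine ⟨∑ x ∈ Λ, (x ⟨0, hd⟩).natAbs, fun x hx => ?_⟩
    rw [Int.abs_eq_natAbs]
    exact_mod_cast Finset.single_le_sum (f := fun x : Site d => (x ⟨0, hd⟩).natAbs)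
      (fun _ _ => Nat.zero_le _) hx
  obtain ⟨M, hM⟩ := hbdd
  exact ⟨2 * ((M : ℝ) + 1) ^ 2, by positivity, fun h hh => poincare hh _ M hM⟩

theorem gaussZ_ne_top (hd : 1 ≤ d) (Λ : Finset (Site d)) {c : ℝ} (hc : 0 < c) :
    gaussZ Λ c ≠ ⊤ := by
  obtain ⟨K, hK, hP⟩ := exists_poincare Λ hd
  have hint : Integrable fun φ : Λ → ℝ => ∏ x, Real.exp (-(c / K) * φ x ^ 2) :=
    Integrable.fintype_prod fun _ => integrable_exp_neg_mul_sq (by positivity)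
  have hfin := hint.lintegral_lt_top
  refine ((lintegral_mono fun φ => ?_).trans_lt hfin).ne
  refine ENNReal.ofReal_le_ofReal ?_
  rw [← Real.exp_sum, Real.exp_le_exp, ← Finset.mul_sum, ← sum_glue (ψ := 0) φ (fun s => s ^ 2)]
  have := hP (glue Λ 0 φ) fun x hx => glue_of_notMem hx
  rw [neg_mul, neg_le_neg_iff, div_mul_eq_mul_div, div_le_iff₀ hK, mul_assoc]
  refine mul_le_mul_of_nonneg_left (this.trans_eq (mul_comm _ _)) hc.le

theorem gaussZ_ne_zero (Λ : Finset (Site d)) (c : ℝ) : gaussZ Λ c ≠ 0 := by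
  rw [gaussZ, Ne, lintegral_eq_zero_iff (measurable_gauss Λ c)]
  intro h
  have : (volume : Measure (Λ → ℝ)) Set.univ = 0 :=
    measure_mono_null (fun φ _ => eexp_ne_zero _) h
  exact (isOpen_univ.measure_pos (volume : Measure (Λ → ℝ)) Set.univ_nonempty).ne' this

/-! ### Exponential moments under the finite-volume Gibbs measures -/

/-- A Hamiltonian with bond potentials `W` and external field `ξ`. -/
noncomputable def hamiltonian (W : Site d → Site d → ℝ → ℝ) (ξ : Site d → ℝ)
    (Λ : Finset (Site d)) (ψ φ : Site d → ℝ) : ℝ :=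
  hamiltonianB W Λ ψ φ - ∑ x ∈ Λ, ξ x * φ x

theorem hamiltonianB_glue (W : Site d → Site d → ℝ → ℝ) (Λ : Finset (Site d)) (ψ : Site d → ℝ)
    (φ : Λ → ℝ) :
    hamiltonianB W Λ ψ (glue Λ ψ φ) =
      bondSum Λ fun x y => W x y (glue Λ ψ φ x - glue Λ ψ φ y) := by
  unfold hamiltonianB bondSum
  congr 1
  refine Finset.sum_congr rfl fun x _ => Finset.sum_congr rfl fun y hy => ?_
  simp only [glue_of_notMem (x := y) ((mem_boundary Λ y).1 (Finset.mem_filter.1 hy).1).1]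

theorem measurable_hamiltonian {W : Site d → Site d → ℝ → ℝ} (ξ : Site d → ℝ)
    (Λ : Finset (Site d)) (ψ : Site d → ℝ) (hW : ∀ x y, Adj x y → Measurable (W x y)) :
    Measurable (hamiltonian W ξ Λ ψ) := by
  unfold hamiltonian hamiltonianB
  refine (Measurable.add ?_ ?_).sub ?_
  · refine (Finset.measurable_sum _ fun x _ => Finset.measurable_sum _ fun y hy => ?_).const_mul _
    exact (hW x y (Finset.mem_filter.1 hy).2).comp
      ((measurable_pi_apply x).sub (measurable_pi_apply y))
  · refine Finset.measurable_sum _ fun x _ => Finset.measurable_sum _ fun y hy => ?_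
    exact (hW x y (Finset.mem_filter.1 hy).2).comp ((measurable_pi_apply x).sub_const _)
  · exact Finset.measurable_sum _ fun x _ => (measurable_pi_apply x).const_mul _

theorem sq_dot_sub_le (u : Fin d → ℝ) {x y : Site d} (h : Adj x y) :
    (dot u x - dot u y) ^ 2 ≤ (∑ i, |u i|) ^ 2 := by
  refine sq_le_sq.2 (le_trans ?_ (le_abs_self _))
  rw [dot, dot, ← Finset.sum_sub_distrib]
  refine (Finset.abs_sum_le_sum_abs _ _).trans (Finset.sum_le_sum fun i _ => ?_)
  rw [← mul_sub, abs_mul]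
  have h1 : |(x i : ℝ) - y i| ≤ 1 := by exact_mod_cast abs_sub_le_one_of_adj h i
  exact mul_le_of_le_one_right (abs_nonneg _) h1

/-- The bounds on the potentials and on the disorder in a finite volume that are needed for the
exponential moment estimate. -/
structure FiniteVolumeBounds (W : Site d → Site d → ℝ → ℝ) (ξ : Site d → ℝ)
    (Λ : Finset (Site d)) (A C c₀ κ : ℝ) (b : Site d → Site d → ℝ) : Prop where
  measurable : ∀ x y, Adj x y → Measurable (W x y)
  A_pos : 0 < A
  C_pos : 0 < C
  c₀_nonneg : 0 ≤ c₀
  upper : ∀ x y, Adj x y → ∀ s, W x y s ≤ C * s ^ 2 + c₀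
  lower : ∀ x y, Adj x y → ∀ s, A * s ^ 2 - b x y ≤ W x y s
  bondSum_le : bondSum Λ b ≤ κ * Λ.card
  field_le : ∀ h : Site d → ℝ, (∀ x ∉ Λ, h x = 0) →
    ∑ x ∈ Λ, ξ x * h x ≤ A / 8 * energy Λ h + κ * Λ.card

namespace FiniteVolumeBounds

variable {W : Site d → Site d → ℝ → ℝ} {ξ : Site d → ℝ} {Λ : Finset (Site d)} {A C c₀ κ : ℝ}
  {b : Site d → Site d → ℝ}

/-- From (a + δ)² ≥ a²/2 - δ², with δ the increment of the tilt, the potentials retain (A/2) E(h);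
the field uses A/8 of it. -/
theorem hamiltonian_ge (H : FiniteVolumeBounds W ξ Λ A C c₀ κ b) (u : Fin d → ℝ) (φ : Λ → ℝ) :
    3 * A / 8 * energy Λ (glue Λ 0 φ) -
      (A * (2 * d * (∑ i, |u i|) ^ 2) + 2 * κ) * Λ.card - ∑ x ∈ Λ, ξ x * dot u x ≤
    hamiltonian W ξ Λ (dot u) (glue Λ (dot u) (φ + fun x : Λ => dot u x)) := by
  have hA := H.A_pos
  rw [hamiltonian, hamiltonianB_glue, glue_eq_add]
  set h := glue Λ 0 φ with hh
  set U := ∑ i, |u i| with hU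
  have h1 : A / 2 * energy Λ h + -A * bondSum Λ (fun _ _ => U ^ 2) + -1 * bondSum Λ b ≤
      bondSum Λ fun x y => W x y (dot u x + h x - (dot u y + h y)) := by
    rw [energy, ← bondSum_mul, ← bondSum_mul, ← bondSum_mul, ← bondSum_add, ← bondSum_add]
    refine bondSum_mono fun x _ y hxy => le_trans ?_ (H.lower x y hxy _)
    have := sq_dot_sub_le u hxy
    nlinarith [sq_nonneg ((h x - h y) + 2 * (dot u x - dot u y))]
  have h2 := bondSum_const_le Λ (sq_nonneg U)
  have h3 := H.bondSum_le
  have h4 := H.field_le h fun x hx => glue_of_notMem hx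
  have h5 : ∑ x ∈ Λ, ξ x * (dot u x + h x) = ∑ x ∈ Λ, ξ x * dot u x + ∑ x ∈ Λ, ξ x * h x := by
    rw [← Finset.sum_add_distrib]
    exact Finset.sum_congr rfl fun x _ => by ring
  rw [h5]
  nlinarith

/-- From (a + δ)² ≤ 2a² + 2δ². The field term is kept exact because symmetry removes it later. -/
theorem hamiltonian_le (H : FiniteVolumeBounds W ξ Λ A C c₀ κ b) (u : Fin d → ℝ) (φ : Λ → ℝ) :
    hamiltonian W ξ Λ (dot u) (glue Λ (dot u) (φ + fun x : Λ => dot u x)) ≤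
    2 * C * energy Λ (glue Λ 0 φ) + 2 * d * (2 * C * (∑ i, |u i|) ^ 2 + c₀) * Λ.card
      - ∑ x ∈ Λ, ξ x * dot u x - ∑ x ∈ Λ, ξ x * glue Λ 0 φ x := by
  have hC := H.C_pos
  have hc₀ := H.c₀_nonneg
  rw [hamiltonian, hamiltonianB_glue, glue_eq_add]
  set h := glue Λ 0 φ with hh
  set U := ∑ i, |u i| with hU
  have h1 : (bondSum Λ fun x y => W x y (dot u x + h x - (dot u y + h y))) ≤
      2 * C * energy Λ h + bondSum Λ (fun _ _ => 2 * C * U ^ 2 + c₀) := by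
    rw [energy, ← bondSum_mul, ← bondSum_add]
    refine bondSum_mono fun x _ y hxy => (H.upper x y hxy _).trans ?_
    have := sq_dot_sub_le u hxy
    nlinarith [sq_nonneg ((h x - h y) - (dot u x - dot u y))]
  have h2 := bondSum_const_le Λ (c := 2 * C * U ^ 2 + c₀) (by positivity)
  have h5 : ∑ x ∈ Λ, ξ x * (dot u x + h x) = ∑ x ∈ Λ, ξ x * dot u x + ∑ x ∈ Λ, ξ x * h x := by
    rw [← Finset.sum_add_distrib]
    exact Finset.sum_congr rfl fun x _ => by ring
  rw [h5]
  linarith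

theorem lintegral_refMeasure (Λ : Finset (Site d)) (ψ : Site d → ℝ) {F : (Site d → ℝ) → ℝ≥0∞}
    (hF : Measurable F) :
    ∫⁻ φ, F φ ∂(refMeasure Λ ψ) = ∫⁻ φ : Λ → ℝ, F (glue Λ ψ (φ + fun x : Λ => ψ x)) := by
  rw [refMeasure, lintegral_map hF (measurable_glue Λ ψ)]
  exact (lintegral_add_right_eq_self (fun φ : Λ → ℝ => F (glue Λ ψ φ)) _).symm

theorem measurable_eexp_hamiltonian (H : FiniteVolumeBounds W ξ Λ A C c₀ κ b) (ψ : Site d → ℝ) :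
    Measurable fun φ => eexp (-hamiltonian W ξ Λ ψ φ) :=
  measurable_eexp.comp (measurable_hamiltonian ξ Λ ψ H.measurable).neg

theorem le_partitionFn (H : FiniteVolumeBounds W ξ Λ A C c₀ κ b) (u : Fin d → ℝ) :
    eexp (∑ x ∈ Λ, ξ x * dot u x - 2 * d * (2 * C * (∑ i, |u i|) ^ 2 + c₀) * Λ.card) *
      gaussZ Λ (2 * C) ≤ partitionFn (hamiltonian W ξ Λ (dot u)) Λ (dot u) := by
  have hmeas : Measurable fun φ : Λ → ℝ => eexp (∑ x ∈ Λ, ξ x * glue Λ 0 φ x -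
      2 * C * energy Λ (glue Λ 0 φ)) := by
    refine measurable_eexp.comp (Measurable.sub ?_ ?_)
    · exact Finset.measurable_sum _ fun x _ =>
        ((measurable_pi_apply x).comp (measurable_glue Λ 0)).const_mul _
    · exact ((measurable_energy Λ).comp (measurable_glue Λ 0)).const_mul _
  -- Averaging over φ and -φ replaces the field factor by a hyperbolic cosine, which is at least 1.
  have hsym : gaussZ Λ (2 * C) ≤ ∫⁻ φ : Λ → ℝ, eexp (∑ x ∈ Λ, ξ x * glue Λ 0 φ x -
      2 * C * energy Λ (glue Λ 0 φ)) := by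
    have h2 : (2 : ℝ≥0∞) * gaussZ Λ (2 * C) ≤ 2 * ∫⁻ φ : Λ → ℝ,
        eexp (∑ x ∈ Λ, ξ x * glue Λ 0 φ x - 2 * C * energy Λ (glue Λ 0 φ)) := by
      conv_rhs => rw [two_mul]
      nth_rewrite 2 [← lintegral_neg_eq_self]
      rw [← lintegral_add_left hmeas, gaussZ, ← lintegral_const_mul _ (measurable_gauss Λ _)]
      refine lintegral_mono fun φ => ?_
      have e : energy Λ (glue Λ 0 (-φ)) = energy Λ (glue Λ 0 φ) := by
        have := energy_smul Λ (-1) (glue Λ 0 φ)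
        rw [glue_neg]
        simpa using this
      rw [e]
      simp only [glue_neg, mul_neg, Finset.sum_neg_distrib]
      set s := ∑ x ∈ Λ, ξ x * glue Λ 0 φ x
      set q := 2 * C * energy Λ (glue Λ 0 φ)
      rw [sub_eq_add_neg, sub_eq_add_neg, eexp_add, eexp_add, ← add_mul]
      gcongr
      rw [eexp, eexp, ← ENNReal.ofReal_add (Real.exp_pos _).le (Real.exp_pos _).le]
      rw [show (2 : ℝ≥0∞) = ENNReal.ofReal 2 by simp]
      refine ENNReal.ofReal_le_ofReal ?_
      have := Real.one_le_cosh s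
      rw [Real.cosh_eq] at this
      linarith
    exact (ENNReal.mul_le_mul_iff_right (by norm_num) (by norm_num)).1 h2
  have hZ : partitionFn (hamiltonian W ξ Λ (dot u)) Λ (dot u) =
      ∫⁻ φ, eexp (-hamiltonian W ξ Λ (dot u) φ) ∂(refMeasure Λ (dot u)) := rfl
  rw [hZ, lintegral_refMeasure Λ _ (H.measurable_eexp_hamiltonian (dot u))]
  calc _ ≤ eexp (∑ x ∈ Λ, ξ x * dot u x - 2 * d * (2 * C * (∑ i, |u i|) ^ 2 + c₀) * Λ.card) *
        ∫⁻ φ : Λ → ℝ, eexp (∑ x ∈ Λ, ξ x * glue Λ 0 φ x -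
          2 * C * energy Λ (glue Λ 0 φ)) := by gcongr
    _ = ∫⁻ φ : Λ → ℝ, eexp (∑ x ∈ Λ, ξ x * dot u x -
        2 * d * (2 * C * (∑ i, |u i|) ^ 2 + c₀) * Λ.card) *
        eexp (∑ x ∈ Λ, ξ x * glue Λ 0 φ x - 2 * C * energy Λ (glue Λ 0 φ)) :=
        (lintegral_const_mul _ hmeas).symm
    _ ≤ _ := by
        refine lintegral_mono fun φ => ?_
        rw [← eexp_add]
        refine eexp_le ?_
        have := H.hamiltonian_le u φ
        linarith

/-- The energy of the deviation of `φ` from the boundary condition. -/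
noncomputable def devEnergy (Λ : Finset (Site d)) (ψ φ : Site d → ℝ) : ℝ :=
  energy Λ fun x => φ x - ψ x

theorem measurable_devEnergy (Λ : Finset (Site d)) (ψ : Site d → ℝ) :
    Measurable (devEnergy Λ ψ) :=
  (measurable_energy Λ).comp (measurable_pi_lambda _ fun x => (measurable_pi_apply x).sub_const _)

/-- Of the coefficient 3A/8 in `hamiltonian_ge`, the exponential weight uses A/8, and A/4 is left
for convergence. -/
theorem lintegral_exp_le (H : FiniteVolumeBounds W ξ Λ A C c₀ κ b) (u : Fin d → ℝ) :
    ∫⁻ φ, eexp (-hamiltonian W ξ Λ (dot u) φ) * eexp (A / 8 * devEnergy Λ (dot u) φ)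
      ∂(refMeasure Λ (dot u)) ≤
    eexp (∑ x ∈ Λ, ξ x * dot u x + (A * (2 * d * (∑ i, |u i|) ^ 2) + 2 * κ) * Λ.card) *
      gaussZ Λ (A / 4) := by
  have hm : Measurable fun φ => eexp (-hamiltonian W ξ Λ (dot u) φ) *
      eexp (A / 8 * devEnergy Λ (dot u) φ) :=
    (H.measurable_eexp_hamiltonian (dot u)).mul
      (measurable_eexp.comp ((measurable_devEnergy Λ _).const_mul _))
  rw [lintegral_refMeasure Λ _ hm, gaussZ,
    ← lintegral_const_mul _ (measurable_gauss Λ _)]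
  refine lintegral_mono fun φ => ?_
  rw [← eexp_add, ← eexp_add]
  refine eexp_le ?_
  have h1 := H.hamiltonian_ge u φ
  have h2 : devEnergy Λ (dot u) (glue Λ (dot u) (φ + fun x : Λ => dot u x)) =
      energy Λ (glue Λ 0 φ) := by
    rw [devEnergy, glue_eq_add]
    simp
  rw [h2]
  linarith

/-- The constant of the exponential moment bound. -/
noncomputable def momentConst (d : ℕ) (u : Fin d → ℝ) (A C c₀ κ : ℝ) : ℝ :=
  A * (2 * d * (∑ i, |u i|) ^ 2) + 2 * κ + 2 * d * (2 * C * (∑ i, |u i|) ^ 2 + c₀) +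
    Real.log (√(8 * C / A))

theorem lintegral_exp_le_partitionFn (H : FiniteVolumeBounds W ξ Λ A C c₀ κ b) (u : Fin d → ℝ) :
    ∫⁻ φ, eexp (-hamiltonian W ξ Λ (dot u) φ) * eexp (A / 8 * devEnergy Λ (dot u) φ)
      ∂(refMeasure Λ (dot u)) ≤
    eexp (momentConst d u A C c₀ κ * Λ.card) *
      partitionFn (hamiltonian W ξ Λ (dot u)) Λ (dot u) := by
  have hA := H.A_pos
  have hC := H.C_pos
  have hr : 0 < √(8 * C / A) := by positivity
  refine (H.lintegral_exp_le u).trans ?_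
  -- The scale r² = 8C/A carries the coefficient A/4 of the numerator to the coefficient 2C of the
  -- partition function.
  rw [gaussZ_scale Λ (A / 4) hr, Real.sq_sqrt (by positivity),
    show A / 4 * (8 * C / A) = 2 * C by field_simp; ring]
  have e : ENNReal.ofReal (√(8 * C / A) ^ Λ.card) = eexp (Real.log (√(8 * C / A)) * Λ.card) := by
    rw [eexp, mul_comm (Real.log _), Real.exp_nat_mul, Real.exp_log hr]
  -- The term ∑ ξ(x) u·x, which need not be of order |Λ|, occurs in both bounds and cancels.
  calc _ = eexp (momentConst d u A C c₀ κ * Λ.card) *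
        (eexp (∑ x ∈ Λ, ξ x * dot u x - 2 * d * (2 * C * (∑ i, |u i|) ^ 2 + c₀) * Λ.card) *
      gaussZ Λ (2 * C)) := by
        rw [e, ← mul_assoc (eexp _) (eexp _), ← mul_assoc (eexp _) (eexp _), ← eexp_add,
          ← eexp_add, momentConst]
        congr 2
        ring
    _ ≤ _ := by
        gcongr
        exact H.le_partitionFn u

theorem partitionFn_ne_zero (H : FiniteVolumeBounds W ξ Λ A C c₀ κ b) (u : Fin d → ℝ) :
    partitionFn (hamiltonian W ξ Λ (dot u)) Λ (dot u) ≠ 0 := by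
  refine ne_of_gt (lt_of_lt_of_le ?_ (H.le_partitionFn u))
  exact pos_iff_ne_zero.2 (mul_ne_zero (eexp_ne_zero _) (gaussZ_ne_zero _ _))

theorem partitionFn_ne_top (hd : 1 ≤ d) (H : FiniteVolumeBounds W ξ Λ A C c₀ κ b)
    (u : Fin d → ℝ) : partitionFn (hamiltonian W ξ Λ (dot u)) Λ (dot u) ≠ ⊤ := by
  have hA := H.A_pos
  have h1 := H.lintegral_exp_le u
  have h2 := ENNReal.mul_ne_top (eexp_ne_top (∑ x ∈ Λ, ξ x * dot u x +
    (A * (2 * d * (∑ i, |u i|) ^ 2) + 2 * κ) * Λ.card)) (gaussZ_ne_top hd Λ (c := A / 4)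
      (by positivity))
  refine ne_top_of_le_ne_top h2 (le_trans (lintegral_mono fun φ => ?_) h1)
  have h3 : 1 ≤ eexp (A / 8 * devEnergy Λ (dot u) φ) := by
    rw [eexp, ENNReal.one_le_ofReal, Real.one_le_exp_iff]
    have : 0 ≤ devEnergy Λ (dot u) φ := energy_nonneg _ _
    positivity
  exact le_mul_of_one_le_right (by positivity) h3

theorem isProbabilityMeasure_gibbs (hd : 1 ≤ d) (H : FiniteVolumeBounds W ξ Λ A C c₀ κ b)
    (u : Fin d → ℝ) :
    IsProbabilityMeasure (gibbs (hamiltonian W ξ Λ (dot u)) Λ (dot u)) := by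
  refine ⟨?_⟩
  rw [gibbs, Measure.smul_apply, withDensity_apply _ MeasurableSet.univ, Measure.restrict_univ,
    smul_eq_mul]
  exact ENNReal.inv_mul_cancel (H.partitionFn_ne_zero u) (H.partitionFn_ne_top hd u)

theorem lintegral_gibbs_exp_le (hd : 1 ≤ d) (H : FiniteVolumeBounds W ξ Λ A C c₀ κ b)
    (u : Fin d → ℝ) :
    ∫⁻ φ, eexp (A / 8 * devEnergy Λ (dot u) φ) ∂(gibbs (hamiltonian W ξ Λ (dot u)) Λ (dot u)) ≤
      eexp (momentConst d u A C c₀ κ * Λ.card) := by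
  have hm : Measurable fun φ => eexp (A / 8 * devEnergy Λ (dot u) φ) :=
    measurable_eexp.comp ((measurable_devEnergy Λ _).const_mul _)
  have hg : gibbs (hamiltonian W ξ Λ (dot u)) Λ (dot u) =
      (partitionFn (hamiltonian W ξ Λ (dot u)) Λ (dot u))⁻¹ • (refMeasure Λ (dot u)).withDensity
        fun φ => eexp (-hamiltonian W ξ Λ (dot u) φ) := rfl
  rw [hg, lintegral_smul_measure, lintegral_withDensity_eq_lintegral_mul _
    (H.measurable_eexp_hamiltonian (dot u)) hm, smul_eq_mul]
  have h0 := H.partitionFn_ne_zero u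
  have h1 := H.partitionFn_ne_top hd u
  rw [mul_comm, ← div_eq_mul_inv, ENNReal.div_le_iff h0 h1]
  exact H.lintegral_exp_le_partitionFn u

theorem gibbs_ae_eq (H : (Site d → ℝ) → ℝ) (Λ : Finset (Site d)) (ψ : Site d → ℝ) :
    ∀ᵐ φ ∂(gibbs H Λ ψ), ∀ x ∉ Λ, φ x = ψ x := by
  have h1 : ∀ᵐ φ ∂(refMeasure Λ ψ), ∀ x ∉ Λ, φ x = ψ x := by
    rw [refMeasure, ae_all_iff]
    intro x
    by_cases hx : x ∈ Λ
    · simp [hx]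
    · rw [ae_map_iff (measurable_glue Λ ψ).aemeasurable]
      · exact Eventually.of_forall fun φ _ => glue_of_notMem hx
      · simp only [hx, not_false_eq_true, forall_const]
        exact measurableSet_eq_fun (measurable_pi_apply x) measurable_const
  exact Measure.ae_smul_measure ((withDensity_absolutelyContinuous _ _).ae_le h1) _

end FiniteVolumeBounds

/-! ### From exponential moments to tilt bounds -/

theorem measurable_tiltDeviation (Λ : Finset (Site d)) (u : Fin d → ℝ) :
    Measurable (tiltDeviation Λ u) := by
  unfold tiltDeviation
  refine Measurable.const_mul (Finset.measurable_sum _ fun x _ => Finset.measurable_sum _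
    fun y _ => ?_) _
  by_cases h : Adj x y
  · simp only [h, dif_pos]
    exact (((measurable_pi_apply _).comp measurable_subtype_coe).sub_const _).pow_const 2
  · simp only [h, dif_neg, not_false_eq_true]
    exact measurable_const

theorem dot_sub (u : Fin d → ℝ) (x y : Site d) : dot u (x - y) = dot u x - dot u y := by
  simp only [dot, ← Finset.sum_sub_distrib]
  exact Finset.sum_congr rfl fun i _ => by simp [mul_sub]

theorem card_mul_tiltDeviation_le {Λ Λ₀ : Finset (Site d)} (h₀ : Λ₀.Nonempty) (u : Fin d → ℝ)
    {φ : Site d → ℝ} (hφ : ∀ x ∉ Λ, φ x = dot u x) :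
    (Λ₀.card : ℝ) * tiltDeviation Λ₀ u (grad φ) ≤ FiniteVolumeBounds.devEnergy Λ (dot u) φ := by
  have h1 := half_sum_le_energy (Λ := Λ) (h := fun x => φ x - dot u x)
    (fun x hx => by simp [hφ x hx]) Λ₀
  refine le_trans (le_of_eq ?_) h1
  have hc : (Λ₀.card : ℝ) ≠ 0 := by exact_mod_cast h₀.card_pos.ne'
  rw [tiltDeviation, ← mul_assoc, show (Λ₀.card : ℝ) * (1 / (2 * (Λ₀.card : ℝ))) = 1 / 2 by
    field_simp]
  congr 1
  refine Finset.sum_congr rfl fun x _ => ?_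
  rw [Finset.sum_filter]
  refine Finset.sum_congr rfl fun y _ => ?_
  by_cases h : Adj x y
  · rw [dif_pos h, if_pos h, dot_sub]
    simp only [grad]
    ring
  · rw [dif_neg h, if_neg h]

/-- The gradient Gibbs measure of a Hamiltonian with bond potentials `W` and field `ξ`. -/
noncomputable def gradGibbs (W : Site d → Site d → ℝ → ℝ) (ξ : Site d → ℝ)
    (Λ : Finset (Site d)) (ψ : Site d → ℝ) : Measure (GradField d) :=
  (gibbs (hamiltonian W ξ Λ ψ) Λ ψ).map grad

theorem gradGibbsA_eq (V : ℝ → ℝ) (ξ : Site d → ℝ) (Λ : Finset (Site d)) (ψ : Site d → ℝ) :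
    gradGibbsA V ξ Λ ψ = gradGibbs (fun _ _ => V) ξ Λ ψ := rfl

theorem gradGibbsB_eq (W : Site d → Site d → ℝ → ℝ) (Λ : Finset (Site d)) (ψ : Site d → ℝ) :
    gradGibbsB W Λ ψ = gradGibbs W 0 Λ ψ := by
  have : hamiltonianB W Λ ψ = hamiltonian W 0 Λ ψ := by
    funext φ
    simp [hamiltonian]
  rw [gradGibbsB, this, gradGibbs]

theorem FiniteVolumeBounds.tiltBound {W : Site d → Site d → ℝ → ℝ} {ξ : Site d → ℝ}
    {Λ Λ₀ : Finset (Site d)} {A C c₀ κ : ℝ} {b : Site d → Site d → ℝ} (hd : 1 ≤ d)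
    (H : FiniteVolumeBounds W ξ Λ A C c₀ κ b) (u : Fin d → ℝ) (h₀ : Λ₀.Nonempty)
    (hcard : Λ.card = Λ₀.card) {t₀ : ℝ} (ht₀ : 16 / A * momentConst d u A C c₀ κ ≤ t₀) :
    TiltBound (gradGibbs W ξ Λ (dot u)) Λ₀ u (A / 16) t₀ := by
  have hA := H.A_pos
  have := H.isProbabilityMeasure_gibbs hd u
  refine ⟨Measure.isProbabilityMeasure_map measurable_grad.aemeasurable, fun t ht => ?_⟩
  rw [gradGibbs, Measure.map_apply measurable_grad
    (measurableSet_lt measurable_const (measurable_tiltDeviation Λ₀ u))]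
  set ν := gibbs (hamiltonian W ξ Λ (dot u)) Λ (dot u) with hν
  set n : ℝ := (Λ₀.card : ℝ) with hn
  set K := momentConst d u A C c₀ κ with hK
  have h1 : ν (grad ⁻¹' {η | t < tiltDeviation Λ₀ u η}) ≤
      ν {φ | eexp (A / 8 * (n * t)) ≤ eexp (A / 8 * devEnergy Λ (dot u) φ)} := by
    refine measure_mono_ae ?_
    filter_upwards [gibbs_ae_eq (hamiltonian W ξ Λ (dot u)) Λ (dot u)] with φ hφ hφt
    refine eexp_le (mul_le_mul_of_nonneg_left ?_ (by positivity))
    refine le_trans ?_ (card_mul_tiltDeviation_le h₀ u hφ)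
    exact mul_le_mul_of_nonneg_left (le_of_lt hφt) (Nat.cast_nonneg _)
  have hm : Measurable fun φ => eexp (A / 8 * devEnergy Λ (dot u) φ) :=
    measurable_eexp.comp ((measurable_devEnergy Λ _).const_mul _)
  have h2 := (mul_meas_ge_le_lintegral (μ := ν) hm (eexp (A / 8 * (n * t)))).trans
    (H.lintegral_gibbs_exp_le hd u)
  have h3 : eexp (K * Λ.card) ≤ eexp (A / 8 * (n * t)) * eexp (-(A / 16 * n * t)) := by
    rw [← eexp_add]
    refine eexp_le ?_
    -- For t > t₀ half of the exponent A/8 pays for the moment constant; the other half is the rate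
    -- A/16.
    have h4 : K ≤ A / 16 * t := by
      have : 16 / A * K ≤ t := ht₀.trans ht.le
      rw [div_mul_eq_mul_div, div_le_iff₀ hA] at this
      linarith
    rw [hcard]
    have hn0 : 0 ≤ n := Nat.cast_nonneg _
    nlinarith
  exact h1.trans ((ENNReal.mul_le_mul_iff_right (eexp_ne_zero _) (eexp_ne_top _)).1 (h2.trans h3))

theorem card_translate (Λ : Finset (Site d)) (v : Site d) : (translate Λ v).card = Λ.card :=
  Finset.card_image_of_injective _ (add_left_injective v)

theorem TiltBound.spatialAverage {μ : Finset (Site d) → Measure (GradField d)}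
    {Λ : Finset (Site d)} (hΛ : Λ.Nonempty) {u : Fin d → ℝ} {β t₀ : ℝ}
    (h : ∀ v ∈ Λ, TiltBound (μ (translate Λ v)) Λ u β t₀) :
    TiltBound (Interface.spatialAverage μ Λ) Λ u β t₀ := by
  have hc : (Λ.card : ℝ≥0∞) ≠ 0 := by exact_mod_cast hΛ.card_pos.ne'
  have hc' : (Λ.card : ℝ≥0∞) ≠ ⊤ := ENNReal.natCast_ne_top _
  constructor
  · refine ⟨?_⟩
    rw [Interface.spatialAverage, Measure.smul_apply, Measure.finsetSum_apply, smul_eq_mul,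
      Finset.sum_congr rfl fun v hv => (h v hv).1.measure_univ]
    simp [ENNReal.inv_mul_cancel hc hc']
  · intro t ht
    rw [Interface.spatialAverage, Measure.smul_apply, Measure.finsetSum_apply, smul_eq_mul,
      mul_comm, ← div_eq_mul_inv, ENNReal.div_le_iff hc hc']
    refine (Finset.sum_le_sum fun v hv => (h v hv).2 t ht).trans ?_
    rw [Finset.sum_const, nsmul_eq_mul, mul_comm]

/-! ### Boxes -/

theorem mem_box {N : ℕ} {x : Site d} : x ∈ box d N ↔ ∀ i, |x i| ≤ N := by
  simp only [box, Finset.mem_Icc, Pi.le_def, abs_le]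
  exact ⟨fun h i => ⟨h.1 i, h.2 i⟩, fun h => ⟨fun i => (h i).1, fun i => (h i).2⟩⟩

theorem zero_mem_box (N : ℕ) : (0 : Site d) ∈ box d N := by simp [mem_box]

theorem box_nonempty (N : ℕ) : (box d N).Nonempty := ⟨0, zero_mem_box N⟩

theorem card_box (N : ℕ) : (box d N).card = (2 * N + 1) ^ d := by
  rw [box, Pi.card_Icc]
  simp only [Int.card_Icc, Finset.prod_const, Finset.card_univ, Fintype.card_fin]
  congr 1
  omega

theorem box_mono {N M : ℕ} (h : N ≤ M) : box d N ⊆ box d M := fun x hx => by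
  rw [mem_box] at *
  exact fun i => (hx i).trans (by exact_mod_cast h)

/-- One estimate of the disorder in the doubled box thus serves all the translates in the spatial
average. -/
theorem translate_box_subset {N : ℕ} {v : Site d} (hv : v ∈ box d N) :
    translate (box d N) v ⊆ box d (2 * N) := fun x hx => by
  obtain ⟨y, hy, rfl⟩ := Finset.mem_image.1 hx
  rw [mem_box] at *
  intro i
  have h1 := hy i
  have h2 := hv i
  simp only [Pi.add_apply]
  rw [abs_le] at *
  push_cast
  constructor <;> omega

theorem card_box_mul_le (k N : ℕ) (hk : 1 ≤ k) : (box d (k * N)).card ≤ k ^ d * (box d N).card := by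
  rw [card_box, card_box, ← mul_pow]
  gcongr
  nlinarith

/-- Bounds in all volumes that are subsets of the doubled box give the two tilt bounds in a box. -/
theorem tiltBound_box_and_average {W : Site d → Site d → ℝ → ℝ} {ξ : Site d → ℝ} {N : ℕ}
    {A C c₀ κ : ℝ} {b : Site d → Site d → ℝ} (hd : 1 ≤ d) (u : Fin d → ℝ)
    (H : ∀ Λ ⊆ box d (2 * N), Λ.card = (box d N).card → FiniteVolumeBounds W ξ Λ A C c₀ κ b)
    {t₀ : ℝ} (ht₀ : 16 / A * FiniteVolumeBounds.momentConst d u A C c₀ κ ≤ t₀) :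
    TiltBound (gradGibbs W ξ (box d N) (dot u)) (box d N) u (A / 16) t₀ ∧
      TiltBound (spatialAverage (fun Λ => gradGibbs W ξ Λ (dot u)) (box d N)) (box d N) u
        (A / 16) t₀ := by
  refine ⟨(H _ (box_mono (by omega)) rfl).tiltBound hd u (box_nonempty N) rfl ht₀,
    TiltBound.spatialAverage (box_nonempty N) fun v hv => ?_⟩
  exact (H _ (translate_box_subset hv) (card_translate _ _)).tiltBound hd u (box_nonempty N)
    (card_translate _ _) ht₀

/-! ### The strong law of large numbers along boxes -/

/-- An increasing exhaustion by finite sets of unbounded cardinality consists of the initial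
segments of an enumeration. -/
theorem exists_enumeration {α : Type*} [Encodable α] [DecidableEq α] {S : ℕ → Finset α}
    (hmono : Monotone S) (hex : ∀ x, ∃ n, x ∈ S n) (hcard : Tendsto (fun n => (S n).card) atTop atTop) :
    ∃ e : ℕ → α, Function.Injective e ∧
      ∀ n, (Finset.range (S n).card).image e = S n := by
  classical
  let level : α → ℕ := fun x => Nat.find (hex x)
  have hlevel : ∀ x n, x ∈ S n ↔ level x ≤ n := fun x n =>
    ⟨fun h => Nat.find_min' _ h, fun h => hmono h (Nat.find_spec (hex x))⟩
  -- Elements are ordered by the step at which they enter the exhaustion, with ties broken by the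
  -- encoding. The rank counts predecessors, all of which lie in the finite set S (level x).
  let key : α → ℕ ×ₗ ℕ := fun x => toLex (level x, Encodable.encode x)
  have hkey : Function.Injective key := fun x y h => by
    have h' : (level x, Encodable.encode x) = (level y, Encodable.encode y) := toLex.injective h
    exact Encodable.encode_injective (Prod.ext_iff.1 h').2
  have hkl : ∀ {x y}, key x < key y → level x ≤ level y := fun {x y} h => by
    rcases Prod.Lex.toLex_lt_toLex.1 h with h | h
    · exact h.le
    · exact h.1.le
  let rank : α → ℕ := fun x => ((S (level x)).filter fun y => key y < key x).card
  have hrank : ∀ {x y}, key x < key y → rank x < rank y := fun {x y} h => by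
    refine Finset.card_lt_card ⟨fun z hz => ?_, fun hsub => ?_⟩
    · rw [Finset.mem_filter] at *
      exact ⟨hmono (hkl h) hz.1, hz.2.trans h⟩
    · have : x ∈ (S (level x)).filter fun z => key z < key x :=
        hsub (Finset.mem_filter.2 ⟨(hlevel x _).2 (hkl h), h⟩)
      exact lt_irrefl _ (Finset.mem_filter.1 this).2
  have hinj : Function.Injective rank := fun x y h => by
    rcases lt_trichotomy (key x) (key y) with h' | h' | h'
    · exact absurd h (hrank h').ne
    · exact hkey h'
    · exact absurd h (hrank h').ne'
  have himage : ∀ n, (S n).image rank = Finset.range (S n).card := fun n => by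
    refine Finset.eq_of_subset_of_card_le (fun k hk => ?_) ?_
    · obtain ⟨x, hx, rfl⟩ := Finset.mem_image.1 hk
      rw [Finset.mem_range]
      refine Finset.card_lt_card ⟨fun z hz => ?_, fun hsub => ?_⟩
      · exact hmono ((hlevel x n).1 hx) (Finset.mem_filter.1 hz).1
      · exact lt_irrefl _ (Finset.mem_filter.1 (hsub hx)).2
    · rw [Finset.card_range, Finset.card_image_of_injective _ hinj]
  have hsurj : Function.Surjective rank := fun k => by
    obtain ⟨n, hn⟩ := (hcard.eventually_gt_atTop k).exists
    have : k ∈ (S n).image rank := by rw [himage]; exact Finset.mem_range.2 hn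
    obtain ⟨x, -, hx⟩ := Finset.mem_image.1 this
    exact ⟨x, hx⟩
  let E := Equiv.ofBijective rank ⟨hinj, hsurj⟩
  refine ⟨E.symm, E.symm.injective, fun n => ?_⟩
  rw [← himage, Finset.image_image]
  have : (E.symm ∘ rank : α → α) = id := funext fun x => E.symm_apply_apply x
  rw [this, Finset.image_id]

theorem tendsto_card_box (hd : 1 ≤ d) : Tendsto (fun N => (box d N).card) atTop atTop := by
  refine tendsto_atTop_mono (fun N => ?_) tendsto_id
  rw [card_box]
  calc id N ≤ (2 * N + 1) ^ 1 := by simp; omega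
    _ ≤ _ := Nat.pow_le_pow_right (by omega) hd

/-- After enumerating the sites box by box, the box averages are a subsequence of the averages of
one sequence, to which the strong law under pairwise independence applies. -/
theorem strong_law_box (hd : 1 ≤ d) {Ω : Type*} [MeasurableSpace Ω] {P : Measure Ω}
    {X : Site d → Ω → ℝ} (hint : ∀ x, Integrable (X x) P)
    (hind : Pairwise fun x y => IndepFun (X x) (X y) P)
    (hid : ∀ x y, IdentDistrib (X x) (X y) P P) :
    ∀ᵐ ω ∂P, Tendsto (fun N => (∑ x ∈ box d N, X x ω) / ((box d N).card : ℝ)) atTop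
      (nhds (∫ ω, X 0 ω ∂P)) := by
  obtain ⟨e, he, hbox⟩ := exists_enumeration (S := box d) (fun _ _ h => box_mono h)
    (fun x => ⟨∑ i, (x i).natAbs, mem_box.2 fun i => by
      rw [Int.abs_eq_natAbs]
      exact_mod_cast Finset.single_le_sum (f := fun i => (x i).natAbs)
        (fun _ _ => Nat.zero_le _) (Finset.mem_univ i)⟩)
    (tendsto_card_box hd)
  have h := strong_law_ae_real (fun n => X (e n)) (hint _)
    (fun i j hij => hind (he.ne hij)) (fun i => hid _ _)
  filter_upwards [h] with ω hω
  have h2 := hω.comp (tendsto_card_box hd)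
  rw [(hid 0 (e 0)).integral_eq]
  refine h2.congr fun N => ?_
  simp only [Function.comp_apply]
  congr 1
  conv_rhs => rw [← hbox N, Finset.sum_image fun _ _ _ _ h => he h]

/-! ### Random bond potentials -/

section ModelB

variable {Ω : Type*} [MeasurableSpace Ω] {P : Measure Ω} {B : Site d → Site d → Ω → ℝ}

/-- Sorting the bonds by direction gives families indexed by sites, with the same conclusion for
directed and undirected bonds. -/
theorem IIDOverBonds.add_single (h : IIDOverBonds P B) (i : Fin d) :
    (Pairwise fun x y : Site d =>
      IndepFun (B x (x + Pi.single i 1)) (B y (y + Pi.single i 1)) P) ∧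
    ∀ x y : Site d, IdentDistrib (B x (x + Pi.single i 1)) (B y (y + Pi.single i 1)) P P := by
  rcases h with ⟨h1, h2⟩ | ⟨-, h1, h2⟩
  · let β : Site d → Bond d := fun x => ⟨(x, x + Pi.single i 1), adj_add_single x i⟩
    refine ⟨fun x y hxy => h1.indepFun (i := β x) (j := β y) fun h => hxy ?_,
      fun x y => h2 (β x) (β y)⟩
    exact congrArg (fun b : Bond d => b.1.1) h
  · exact ⟨fun x y hxy => h1.indepFun (i := (x, i)) (j := (y, i)) fun h => hxy (Prod.ext_iff.1 h).1,
      fun x y => h2 (x, i) (y, i)⟩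

theorem IIDOverBonds.sub_single (h : IIDOverBonds P B) (i : Fin d) :
    (Pairwise fun x y : Site d =>
      IndepFun (B x (x - Pi.single i 1)) (B y (y - Pi.single i 1)) P) ∧
    ∀ x y : Site d, IdentDistrib (B x (x - Pi.single i 1)) (B y (y - Pi.single i 1)) P P := by
  rcases id h with ⟨h1, h2⟩ | ⟨hs, -, -⟩
  · let β : Site d → Bond d := fun x => ⟨(x, x - Pi.single i 1), adj_sub_single x i⟩
    refine ⟨fun x y hxy => h1.indepFun (i := β x) (j := β y) fun h => hxy ?_,
      fun x y => h2 (β x) (β y)⟩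
    exact congrArg (fun b : Bond d => b.1.1) h
  · obtain ⟨h1, h2⟩ := h.add_single i
    have e : ∀ x : Site d, B x (x - Pi.single i 1) =
        B (x - Pi.single i 1) (x - Pi.single i 1 + Pi.single i 1) := fun x => by
      rw [sub_add_cancel, hs _ _ (adj_sub_single x i)]
    refine ⟨fun x y hxy => ?_, fun x y => ?_⟩
    · beta_reduce
      rw [e x, e y]
      exact h1 fun h => hxy (sub_left_injective h)
    · rw [e x, e y]
      exact h2 _ _

/-- The averages over boxes of the moduli of integrable i.i.d. bond variables converge. -/
theorem exists_tendsto_bond_average (hd : 1 ≤ d) (hB : IIDOverBonds P B)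
    (hint : ∀ x y, Adj x y → Integrable (B x y) P) :
    ∃ L : ℝ, 0 ≤ L ∧ ∀ᵐ ω ∂P, Tendsto (fun N =>
      (∑ x ∈ box d N, ∑ y ∈ nbr x, |B x y ω|) / ((box d N).card : ℝ)) atTop (nhds L) := by
  have h1 : ∀ i : Fin d, ∀ᵐ ω ∂P, Tendsto (fun N =>
      (∑ x ∈ box d N, |B x (x + Pi.single i 1) ω|) / ((box d N).card : ℝ)) atTop
        (nhds (∫ ω, |B 0 (0 + Pi.single i 1) ω| ∂P)) := fun i =>
    strong_law_box hd (X := fun x ω => |B x (x + Pi.single i 1) ω|)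
      (fun x => (hint _ _ (adj_add_single x i)).abs)
      (fun x y hxy => ((hB.add_single i).1 hxy).comp measurable_norm measurable_norm)
      (fun x y => ((hB.add_single i).2 x y).comp measurable_norm)
  have h2 : ∀ i : Fin d, ∀ᵐ ω ∂P, Tendsto (fun N =>
      (∑ x ∈ box d N, |B x (x - Pi.single i 1) ω|) / ((box d N).card : ℝ)) atTop
        (nhds (∫ ω, |B 0 (0 - Pi.single i 1) ω| ∂P)) := fun i =>
    strong_law_box hd (X := fun x ω => |B x (x - Pi.single i 1) ω|)
      (fun x => (hint _ _ (adj_sub_single x i)).abs)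
      (fun x y hxy => ((hB.sub_single i).1 hxy).comp measurable_norm measurable_norm)
      (fun x y => ((hB.sub_single i).2 x y).comp measurable_norm)
  refine ⟨∑ i, (∫ ω, |B 0 (0 + Pi.single i 1) ω| ∂P + ∫ ω, |B 0 (0 - Pi.single i 1) ω| ∂P),
    Finset.sum_nonneg fun i _ => add_nonneg (integral_nonneg fun _ => abs_nonneg _)
      (integral_nonneg fun _ => abs_nonneg _), ?_⟩
  filter_upwards [ae_all_iff.2 h1, ae_all_iff.2 h2] with ω hω1 hω2
  refine (tendsto_finsetSum Finset.univ fun i _ => (hω1 i).add (hω2 i)).congr fun N => ?_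
  simp only [sum_nbr _ fun y => |B _ y ω|]
  rw [Finset.sum_comm, Finset.sum_div]
  exact Finset.sum_congr rfl fun i _ => by rw [← add_div, ← Finset.sum_add_distrib]

theorem finiteVolumeBounds_of_bondSum_le {W : Site d → Site d → ℝ → ℝ}
    {b : Site d → Site d → ℝ} {A C κ : ℝ} {Λ : Finset (Site d)}
    (hA : 0 < A) (hC : 0 < C) (hκ : 0 ≤ κ) (hW : ∀ x y, Adj x y → Measurable (W x y))
    (hbounds : ∀ x y, Adj x y → ∀ s, A * s ^ 2 - b x y ≤ W x y s ∧ W x y s ≤ C * s ^ 2)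
    (hb : bondSum Λ b ≤ κ * Λ.card) : FiniteVolumeBounds W 0 Λ A C 0 κ b where
  measurable := hW
  A_pos := hA
  C_pos := hC
  c₀_nonneg := le_rfl
  upper x y h s := by simpa using (hbounds x y h s).2
  lower x y h s := (hbounds x y h s).1
  bondSum_le := hb
  field_le h _ := by
    have := energy_nonneg Λ h
    simp only [Pi.zero_apply, zero_mul, Finset.sum_const_zero]
    positivity

/-- Moduli make the sum monotone in the volume; passing to the doubled box costs the factor 2^d. -/
theorem bondSum_le_of_box {b : Site d → Site d → ℝ} {κ : ℝ} {N : ℕ} (hκ : 0 ≤ κ)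
    (h : ∑ x ∈ box d (2 * N), ∑ y ∈ nbr x, |b x y| ≤ κ * (box d (2 * N)).card)
    {Λ : Finset (Site d)} (hΛ : Λ ⊆ box d (2 * N)) (hcard : Λ.card = (box d N).card) :
    bondSum Λ b ≤ 2 ^ d * κ * Λ.card := by
  have hc : ((box d (2 * N)).card : ℝ) ≤ 2 ^ d * Λ.card := by
    rw [hcard]
    exact_mod_cast card_box_mul_le 2 N (by norm_num)
  calc bondSum Λ b ≤ bondSum Λ fun x y => |b x y| := bondSum_mono fun _ _ _ _ => le_abs_self _
    _ ≤ ∑ x ∈ Λ, ∑ y ∈ nbr x, |b x y| := bondSum_le_sum_nbr fun _ _ _ _ => abs_nonneg _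
    _ ≤ ∑ x ∈ box d (2 * N), ∑ y ∈ nbr x, |b x y| :=
        Finset.sum_le_sum_of_subset_of_nonneg hΛ fun _ _ _ =>
          Finset.sum_nonneg fun _ _ => abs_nonneg _
    _ ≤ κ * (2 ^ d * Λ.card) := h.trans (mul_le_mul_of_nonneg_left hc hκ)
    _ = _ := by ring

end ModelB

/-! ### Tilt bounds for model B -/

theorem tiltBound_modelB {Ω : Type*} [MeasurableSpace Ω] (P : Measure Ω)
    (d : ℕ) (hd : 1 ≤ d) (V : Site d → Site d → Ω → ℝ → ℝ) (A C₂ : ℝ)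
    (B : Site d → Site d → Ω → ℝ) (hM : IsModelB P V A C₂ B) (u : Fin d → ℝ) :
    ∃ β t₀ : ℝ, 0 < β ∧ 0 < t₀ ∧
      (∀ᵐ ω ∂P,
        (∀ᶠ N : ℕ in atTop,
          TiltBound (gradGibbsB (fun x y => V x y ω) (box d N) (dot u)) (box d N) u β t₀ ∧
          TiltBound (spatialAverage (fun Λ => gradGibbsB (fun x y => V x y ω) Λ (dot u))
            (box d N)) (box d N) u β t₀) ∧
        (∃ t₁ : ℝ, 0 < t₁ ∧ ∀ N : ℕ,
          TiltBound (gradGibbsB (fun x y => V x y ω) (box d N) (dot u)) (box d N) u β t₁ ∧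
          TiltBound (spatialAverage (fun Λ => gradGibbsB (fun x y => V x y ω) Λ (dot u))
            (box d N)) (box d N) u β t₁)) ∧
      ((∃ b : ℝ, ∀ᵐ ω ∂P, ∀ x y, Adj x y → B x y ω ≤ b) →
        ∀ᵐ ω ∂P, ∀ N : ℕ,
          TiltBound (gradGibbsB (fun x y => V x y ω) (box d N) (dot u)) (box d N) u β t₀ ∧
          TiltBound (spatialAverage (fun Λ => gradGibbsB (fun x y => V x y ω) Λ (dot u))
            (box d N)) (box d N) u β t₀) := by
  simp only [gradGibbsB_eq]
  have hA := hM.A_pos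
  have hC := hM.C₂_pos
  have hW : ∀ ω x y, Adj x y → Measurable (V x y ω) := fun ω x y h =>
    (hM.contDiff x y h ω).continuous.measurable
  obtain ⟨L, hL, hlim⟩ := exists_tendsto_bond_average hd hM.iid_B hM.integrable_B
  -- The threshold t₀ must be fixed before boundedness of B is assumed, so b₀ is a bound if there is
  -- one and 0 otherwise.
  have hbdd : ∃ b₀ : ℝ, 0 ≤ b₀ ∧ ((∃ b : ℝ, ∀ᵐ ω ∂P, ∀ x y, Adj x y → B x y ω ≤ b) →
      ∀ᵐ ω ∂P, ∀ x y, Adj x y → B x y ω ≤ b₀) := by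
    by_cases h : ∃ b : ℝ, ∀ᵐ ω ∂P, ∀ x y, Adj x y → B x y ω ≤ b
    · obtain ⟨b, hb⟩ := h
      refine ⟨max b 0, le_max_right _ _, fun _ => ?_⟩
      filter_upwards [hb] with ω hω x y hxy
      exact (hω x y hxy).trans (le_max_left _ _)
    · exact ⟨0, le_rfl, fun h' => absurd h' h⟩
  obtain ⟨b₀, hb₀, hbdd⟩ := hbdd
  -- The first summand serves large volumes, through averages eventually below L + 1; the second
  -- serves bounded B. Their sum gives a common threshold.
  set κ : ℝ := 2 ^ d * (L + 1) + 2 * d * b₀ with hκ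
  have hκ0 : 0 ≤ κ := by positivity
  refine ⟨A / 16, max 1 (16 / A * FiniteVolumeBounds.momentConst d u A C₂ 0 κ), by positivity,
    lt_max_of_lt_left one_pos, ?_, fun hb => ?_⟩
  · filter_upwards [hlim, hM.bounds] with ω hω hωb
    have key : ∀ (K : ℝ) (N : ℕ), 0 ≤ K → ∑ x ∈ box d (2 * N), ∑ y ∈ nbr x, |B x y ω| ≤
        K * (box d (2 * N)).card → ∀ κ', 2 ^ d * K ≤ κ' → ∀ Λ ⊆ box d (2 * N),
        Λ.card = (box d N).card →
        FiniteVolumeBounds (fun x y => V x y ω) 0 Λ A C₂ 0 κ' (fun x y => B x y ω) := by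
      intro K N hK h κ' hκ' Λ hΛ hcard
      refine finiteVolumeBounds_of_bondSum_le hA hC ((by positivity : 0 ≤ 2 ^ d * K).trans hκ')
        (hW ω) hωb ((bondSum_le_of_box hK h hΛ hcard).trans ?_)
      gcongr
    have hpos : ∀ N, (0 : ℝ) < (box d N).card := fun N => by
      exact_mod_cast (box_nonempty N).card_pos
    constructor
    · have h1 : ∀ᶠ N in atTop, (∑ x ∈ box d N, ∑ y ∈ nbr x, |B x y ω|) / ((box d N).card : ℝ) ≤
          L + 1 := hω.eventually_le_const (by linarith)
      have h2 : Tendsto (fun N : ℕ => 2 * N) atTop atTop :=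
        tendsto_atTop_mono (fun N => by simp only [id]; omega) tendsto_id
      filter_upwards [h2.eventually h1] with N hN
      rw [div_le_iff₀ (hpos _)] at hN
      exact tiltBound_box_and_average hd u
        (key (L + 1) N (by positivity) hN κ (le_add_of_nonneg_right (by positivity)))
        (le_max_right _ _)
    -- A convergent sequence is bounded, which covers all N at the price of a random constant.
    · obtain ⟨K, hK⟩ := hω.bddAbove_range
      refine ⟨max 1 (16 / A * FiniteVolumeBounds.momentConst d u A C₂ 0 (2 ^ d * max K 0)),
        lt_max_of_lt_left one_pos, fun N => ?_⟩
      have hN := (hK (Set.mem_range_self (2 * N))).trans (le_max_left K 0)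
      rw [div_le_iff₀ (hpos _)] at hN
      exact tiltBound_box_and_average hd u
        (key (max K 0) N (le_max_right _ _) hN _ le_rfl) (le_max_right _ _)
  · filter_upwards [hbdd hb, hM.bounds] with ω hω hωb N
    refine tiltBound_box_and_average (b := fun _ _ => b₀) hd u (fun Λ _ _ =>
      finiteVolumeBounds_of_bondSum_le hA hC hκ0 (hW ω) (fun x y hxy s => ?_) ?_)
      (le_max_right _ _)
    · exact ⟨le_trans (by linarith [hω x y hxy]) (hωb x y hxy s).1, (hωb x y hxy s).2⟩
    · refine (bondSum_const_le Λ hb₀).trans ?_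
      gcongr
      exact le_add_of_nonneg_left (by positivity)

/-! ### The Green function of a box -/

theorem glue_zero_add (Λ : Finset (Site d)) (φ χ : Λ → ℝ) :
    glue Λ 0 (φ + χ) = fun x => glue Λ 0 φ x + glue Λ 0 χ x := by
  funext x
  by_cases h : x ∈ Λ <;> simp [glue, h]

/-- The bilinear form of the Dirichlet energy. -/
noncomputable def energyForm (Λ : Finset (Site d)) : (Λ → ℝ) →ₗ[ℝ] (Λ → ℝ) →ₗ[ℝ] ℝ :=
  LinearMap.mk₂ ℝ (fun φ χ => bondSum Λ fun x y =>
      (glue Λ 0 φ x - glue Λ 0 φ y) * (glue Λ 0 χ x - glue Λ 0 χ y))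
    (fun φ₁ φ₂ χ => by
      rw [← bondSum_add, glue_zero_add]
      exact bondSum_congr fun _ _ _ _ => by ring)
    (fun c φ χ => by
      rw [smul_eq_mul, ← bondSum_mul, glue_smul]
      exact bondSum_congr fun _ _ _ _ => by ring)
    (fun φ χ₁ χ₂ => by
      rw [← bondSum_add, glue_zero_add]
      exact bondSum_congr fun _ _ _ _ => by ring)
    (fun c φ χ => by
      rw [smul_eq_mul, ← bondSum_mul, glue_smul]
      exact bondSum_congr fun _ _ _ _ => by ring)

theorem energyForm_self (Λ : Finset (Site d)) (φ : Λ → ℝ) :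
    energyForm Λ φ φ = energy Λ (glue Λ 0 φ) :=
  bondSum_congr fun _ _ _ _ => (sq _).symm

theorem energyForm_comm (Λ : Finset (Site d)) (φ χ : Λ → ℝ) :
    energyForm Λ φ χ = energyForm Λ χ φ :=
  bondSum_congr fun _ _ _ _ => mul_comm _ _

/-- The Poincaré inequality makes the energy form nondegenerate, so evaluation at x is represented
by a vector: the column of the Green function at x. -/
theorem exists_green_vector (hd : 1 ≤ d) (Λ : Finset (Site d)) :
    ∃ g : Λ → (Λ → ℝ), ∀ x χ, energyForm Λ (g x) χ = χ x := by
  obtain ⟨K, hK, hP⟩ := exists_poincare Λ hd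
  have hinj : Function.Injective (energyForm Λ) := by
    rw [injective_iff_map_eq_zero]
    intro φ hφ
    have h1 : energy Λ (glue Λ 0 φ) = 0 := by rw [← energyForm_self, hφ]; rfl
    have h2 := hP (glue Λ 0 φ) fun x hx => glue_of_notMem hx
    rw [h1, mul_zero, sum_glue φ fun s => s ^ 2] at h2
    funext x
    have h3 := Finset.single_le_sum (f := fun x => φ x ^ 2) (fun _ _ => sq_nonneg _)
      (Finset.mem_univ x)
    exact pow_eq_zero_iff two_ne_zero |>.1 (le_antisymm (h3.trans h2) (sq_nonneg _))
  have hsurj : Function.Surjective (energyForm Λ) :=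
    (LinearMap.injective_iff_surjective_of_finrank_eq_finrank
      (Subspace.dual_finrank_eq (K := ℝ) (V := Λ → ℝ)).symm).1 hinj
  choose g hg using fun x : Λ => hsurj (LinearMap.proj x)
  exact ⟨g, fun x χ => by rw [hg]; rfl⟩

/-- Bounds on the Green function of a box in dimension at least three, together with its
variational characterization. -/
theorem exists_green (hd : 3 ≤ d) :
    ∃ C : ℝ, 0 < C ∧ ∀ N : ℕ, ∃ G : Site d → Site d → ℝ,
      (∀ ξ h : Site d → ℝ, (∀ x ∉ box d N, h x = 0) → ∀ ε : ℝ, 0 < ε →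
        ∑ x ∈ box d N, ξ x * h x ≤ ε * energy (box d N) h +
          1 / (4 * ε) * ∑ x ∈ box d N, ∑ y ∈ box d N, G x y * (ξ x * ξ y)) ∧
      (∀ x ∈ box d N, G x x ≤ C) ∧
      (∀ x ∈ box d N, ∑ y ∈ box d N, G x y ^ 2 ≤ C * ((N : ℝ) + 1) ^ 2) := by
  obtain ⟨C, hC, hpt⟩ := exists_sq_le_energy hd
  refine ⟨2 * C, by positivity, fun N => ?_⟩
  set Λ := box d N with hΛ
  obtain ⟨g, hg⟩ := exists_green_vector (by omega) Λ
  have hself : ∀ x : Λ, energy Λ (glue Λ 0 (g x)) = g x x := fun x => by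
    rw [← energyForm_self, hg]
  -- Since g x x is both the value at x and the energy of g x, the pointwise bound reads (g x x)² ≤
  -- C g x x.
  have hdiag : ∀ x : Λ, g x x ≤ C := fun x => by
    have h1 := hpt Λ (glue Λ 0 (g x)) (fun y hy => glue_of_notMem hy) x
    rw [hself, glue_coe] at h1
    by_contra! hlt
    nlinarith
  refine ⟨fun x y => if hx : x ∈ Λ then glue Λ 0 (g ⟨x, hx⟩) y else 0, ?_, ?_, ?_⟩
  · intro ξ h hh ε hε
    set χ : Λ → ℝ := fun x => h x with hχ
    have hχh : glue Λ 0 χ = h := by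
      funext x
      by_cases hx : x ∈ Λ
      · simp [glue, hx, hχ]
      · simp [glue, hx, hh x hx]
    set w : Λ → ℝ := ∑ x : Λ, ξ x • g x with hw
    have hwχ : ∀ χ : Λ → ℝ, energyForm Λ w χ = ∑ x : Λ, ξ x * χ x := fun χ => by
      simp only [hw, map_sum, map_smul, LinearMap.sum_apply, LinearMap.smul_apply, hg, smul_eq_mul]
    have h1 : ∑ x ∈ Λ, ξ x * h x = energyForm Λ w χ := by
      rw [hwχ, ← Finset.sum_coe_sort Λ fun x => ξ x * h x]
    have h2 : ∑ x ∈ Λ, ∑ y ∈ Λ, (if hx : x ∈ Λ then glue Λ 0 (g ⟨x, hx⟩) y else 0) * (ξ x * ξ y) =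
        energyForm Λ w w := by
      rw [hwχ, ← Finset.sum_coe_sort Λ fun x => ∑ y ∈ Λ,
        (if hx : x ∈ Λ then glue Λ 0 (g ⟨x, hx⟩) y else 0) * (ξ x * ξ y)]
      have e : ∀ y : Λ, ξ y * w y = ∑ x : Λ, g x y * (ξ x * ξ y) := fun y => by
        rw [hw, Finset.sum_apply, Finset.mul_sum]
        exact Finset.sum_congr rfl fun x _ => by simp; ring
      simp only [e]
      conv_rhs => rw [Finset.sum_comm]
      refine Finset.sum_congr rfl fun x _ => ?_
      rw [← Finset.sum_coe_sort Λ fun y =>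
        (if hx : (x : Site d) ∈ Λ then glue Λ 0 (g ⟨x, hx⟩) y else 0) * (ξ x * ξ y)]
      refine Finset.sum_congr rfl fun y _ => ?_
      rw [dif_pos x.2, glue_coe]
    -- Completing the square: w = Gξ represents h ↦ ∑ ξ h, and the energy of 2εh - w is nonnegative.
    have h3 : 0 ≤ energyForm Λ ((2 * ε) • χ - w) ((2 * ε) • χ - w) := by
      rw [energyForm_self]
      exact energy_nonneg _ _
    simp only [map_sub, map_smul, LinearMap.sub_apply, LinearMap.smul_apply, smul_eq_mul,
      energyForm_comm Λ χ w] at h3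
    rw [h1, h2, ← hχh, ← energyForm_self]
    have h4 : 0 ≤ (4 * ε ^ 2 * energyForm Λ χ χ - 4 * ε * energyForm Λ w χ + energyForm Λ w w) /
        (4 * ε) := div_nonneg (by nlinarith) (by positivity)
    have h5 : (4 * ε ^ 2 * energyForm Λ χ χ - 4 * ε * energyForm Λ w χ + energyForm Λ w w) /
        (4 * ε) = ε * energyForm Λ χ χ - energyForm Λ w χ +
          1 / (4 * ε) * energyForm Λ w w := by
      field_simp
    linarith
  · intro x hx
    have h1 := hdiag ⟨x, hx⟩
    have h2 := glue_coe (Λ := Λ) (ψ := 0) (φ := g ⟨x, hx⟩) ⟨x, hx⟩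
    simp only [hx, dif_pos]
    rw [h2]
    linarith
  · intro x hx
    simp only [hx, dif_pos]
    -- The squared norm of a column is at most 2(N+1)² times its energy, which is the bounded
    -- diagonal entry.
    have h1 := poincare (Λ := Λ) (h := glue Λ 0 (g ⟨x, hx⟩)) (fun y hy => glue_of_notMem hy)
      ⟨0, by omega⟩ N fun y hy => mem_box.1 hy _
    refine h1.trans ?_
    rw [hself]
    have := hdiag ⟨x, hx⟩
    nlinarith [sq_nonneg ((N : ℝ) + 1)]

/-! ### Off-diagonal quadratic forms of independent random variables -/

section QuadraticForm

variable {Ω ι : Type*} [MeasurableSpace Ω] {P : Measure Ω} {X : ι → Ω → ℝ}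

theorem integral_mul_four_eq_zero [DecidableEq ι] (hind : iIndepFun X P) (hmeas : ∀ x, Measurable (X x))
    {x y z w : ι} (hx : ∫ ω, X x ω ∂P = 0) (hxy : x ≠ y) (hxz : x ≠ z) (hxw : x ≠ w) :
    ∫ ω, X x ω * X y ω * (X z ω * X w ω) ∂P = 0 := by
  have h1 := hind.indepFun_finset {x} {y, z, w} (by simp [hxy, hxz, hxw]) hmeas
  have h2 : IndepFun (X x) (fun ω => X y ω * (X z ω * X w ω)) P := by
    refine h1.comp (φ := fun f => f ⟨x, by simp⟩)
      (ψ := fun f => f ⟨y, by simp⟩ * (f ⟨z, by simp⟩ * f ⟨w, by simp⟩)) ?_ ?_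
    · exact measurable_pi_apply _
    · exact (measurable_pi_apply _).mul ((measurable_pi_apply _).mul (measurable_pi_apply _))
  have h3 := h2.integral_mul_eq_mul_integral (hmeas x).aestronglyMeasurable
    ((hmeas y).mul ((hmeas z).mul (hmeas w))).aestronglyMeasurable
  rw [hx, zero_mul] at h3
  rw [← h3]
  exact integral_congr_ae (Eventually.of_forall fun ω => by simp [mul_assoc])

/-- Squares of independent variables are independent, so products over distinct indices need only
second moments. -/
theorem memLp_mul_of_indep (hind : iIndepFun X P) (hmeas : ∀ x, Measurable (X x))
    (hL2 : ∀ x, MemLp (X x) 2 P) {x y : ι} (hxy : x ≠ y) :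
    MemLp (fun ω => X x ω * X y ω) 2 P := by
  refine (memLp_two_iff_integrable_sq (f := fun ω => X x ω * X y ω)
    ((hmeas x).mul (hmeas y)).aestronglyMeasurable).2 ?_
  have h := ((hind.indepFun hxy).comp (φ := fun s => s ^ 2) (ψ := fun s => s ^ 2)
    (by fun_prop) (by fun_prop)).integrable_mul (hL2 x).integrable_sq (hL2 y).integrable_sq
  exact h.congr (Eventually.of_forall fun ω => by simp [mul_pow])

theorem integral_sq_mul_sq (hind : iIndepFun X P) (hmeas : ∀ x, Measurable (X x))
    {v : ℝ} (hv : ∀ x, ∫ ω, X x ω ^ 2 ∂P = v) {x y : ι} (hxy : x ≠ y) :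
    ∫ ω, (X x ω * X y ω) * (X x ω * X y ω) ∂P = v ^ 2 := by
  have h := ((hind.indepFun hxy).comp (φ := fun s => s ^ 2) (ψ := fun s => s ^ 2)
    (by fun_prop) (by fun_prop)).integral_mul_eq_mul_integral
      ((hmeas x).pow_const 2).aestronglyMeasurable ((hmeas y).pow_const 2).aestronglyMeasurable
  have e : ∀ x, ∫ ω, ((fun s : ℝ => s ^ 2) ∘ X x) ω ∂P = v := hv
  rw [e, e] at h
  rw [sq, ← h]
  exact integral_congr_ae (Eventually.of_forall fun ω => by simp; ring)

/-- Products over two pairs of distinct indices are uncorrelated unless the pairs agree up to order,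
so each row of the covariance matrix has at most two nonzero entries, both v². -/
theorem integral_sq_offDiag_le [DecidableEq ι] (hind : iIndepFun X P) (hmeas : ∀ x, Measurable (X x))
    (hL2 : ∀ x, MemLp (X x) 2 P) (hmean : ∀ x, ∫ ω, X x ω ∂P = 0)
    {v : ℝ} (hv : ∀ x, ∫ ω, X x ω ^ 2 ∂P = v) (s : Finset ι) (a : ι → ι → ℝ) :
    Integrable (fun ω => (∑ p ∈ s.offDiag, a p.1 p.2 * (X p.1 ω * X p.2 ω)) ^ 2) P ∧
    ∫ ω, (∑ p ∈ s.offDiag, a p.1 p.2 * (X p.1 ω * X p.2 ω)) ^ 2 ∂P ≤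
      2 * v ^ 2 * ∑ p ∈ s.offDiag, a p.1 p.2 ^ 2 := by
  set T := s.offDiag with hT
  set Z : ι × ι → Ω → ℝ := fun p ω => X p.1 ω * X p.2 ω with hZ
  have hne : ∀ p ∈ T, p.1 ≠ p.2 := fun p hp => (Finset.mem_offDiag.1 hp).2.2
  have hint : ∀ p ∈ T, ∀ q ∈ T, Integrable (fun ω => Z p ω * Z q ω) P := fun p hp q hq =>
    (memLp_mul_of_indep hind hmeas hL2 (hne p hp)).integrable_mul
      (memLp_mul_of_indep hind hmeas hL2 (hne q hq))
  have hexp : ∀ ω, (∑ p ∈ T, a p.1 p.2 * (X p.1 ω * X p.2 ω)) ^ 2 =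
      ∑ p ∈ T, ∑ q ∈ T, a p.1 p.2 * a q.1 q.2 * (Z p ω * Z q ω) := fun ω => by
    rw [sq, Finset.sum_mul_sum]
    exact Finset.sum_congr rfl fun p _ => Finset.sum_congr rfl fun q _ => by ring
  simp only [hexp]
  have hint' : ∀ p ∈ T, ∀ q ∈ T,
      Integrable (fun ω => a p.1 p.2 * a q.1 q.2 * (Z p ω * Z q ω)) P := fun p hp q hq =>
    (hint p hp q hq).const_mul _
  refine ⟨integrable_finsetSum _ fun p hp => integrable_finsetSum _ fun q hq =>
    hint' p hp q hq, ?_⟩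
  rw [integral_finsetSum _ fun p hp => integrable_finsetSum _ fun q hq => hint' p hp q hq]
  rw [Finset.sum_congr rfl fun p hp => integral_finsetSum T fun q hq => hint' p hp q hq]
  simp only [integral_const_mul]
  set M : ι × ι → ι × ι → ℝ := fun p q => if q = p ∨ q = p.swap then v ^ 2 else 0 with hM
  have hMbound : ∀ p ∈ T, ∀ q ∈ T, |∫ ω, Z p ω * Z q ω ∂P| ≤ M p q := by
    rintro ⟨x, y⟩ hp ⟨z, w⟩ hq
    have h1 : x ≠ y := hne _ hp
    have h2 : z ≠ w := hne _ hq
    simp only [hM, hZ]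
    split_ifs with h
    · have : ∫ ω, X x ω * X y ω * (X z ω * X w ω) ∂P = v ^ 2 := by
        rw [← integral_sq_mul_sq hind hmeas hv h1]
        rcases h with h | h
        · obtain ⟨rfl, rfl⟩ := Prod.mk.inj h
          rfl
        · obtain ⟨rfl, rfl⟩ := Prod.mk.inj h
          exact integral_congr_ae (Eventually.of_forall fun ω => by ring)
      rw [this, abs_of_nonneg (sq_nonneg v)]
    · rw [not_or] at h
      simp only [Prod.swap_prod_mk, Prod.mk.injEq, not_and] at h
      have : ∫ ω, X x ω * X y ω * (X z ω * X w ω) ∂P = 0 := by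
        -- The pairs do not agree up to order, so x or y occurs exactly once and its zero mean
        -- factors out.
        by_cases hx : x = z ∨ x = w
        · have h3 : y ≠ z ∧ y ≠ w := by
            constructor <;> rintro rfl <;> rcases hx with rfl | rfl <;> simp_all
          rw [← integral_mul_four_eq_zero hind hmeas (hmean y) h1.symm h3.1 h3.2]
          exact integral_congr_ae (Eventually.of_forall fun ω => by ring)
        · rw [not_or] at hx
          exact integral_mul_four_eq_zero hind hmeas (hmean x) h1 hx.1 hx.2
      rw [this, abs_zero]
  have hMsymm : ∀ p q, M p q = M q p := fun p q => by
    simp only [hM]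
    refine if_congr ?_ rfl rfl
    constructor <;> rintro (rfl | rfl) <;> simp
  have hMsum : ∀ p, ∑ q ∈ T, M p q ≤ 2 * v ^ 2 := fun p => by
    simp only [hM]
    rw [← Finset.sum_filter, Finset.sum_const, nsmul_eq_mul]
    refine mul_le_mul_of_nonneg_right ?_ (sq_nonneg v)
    have : (T.filter fun q => q = p ∨ q = p.swap) ⊆ {p, p.swap} := fun q hq => by
      simpa using (Finset.mem_filter.1 hq).2
    exact_mod_cast (Finset.card_le_card this).trans Finset.card_le_two
  -- Schur's test: 2|ab| ≤ a² + b², then the row sums of the symmetric matrix M.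
  calc ∑ p ∈ T, ∑ q ∈ T, a p.1 p.2 * a q.1 q.2 * ∫ ω, Z p ω * Z q ω ∂P
      ≤ ∑ p ∈ T, ∑ q ∈ T, (1 / 2 * (a p.1 p.2 ^ 2 * M p q) + 1 / 2 * (a q.1 q.2 ^ 2 * M q p)) := by
        gcongr with p hp q hq
        have h1 := hMbound p hp q hq
        have h0 := abs_nonneg (∫ ω, Z p ω * Z q ω ∂P)
        rw [hMsymm q p]
        calc _ ≤ |a p.1 p.2 * a q.1 q.2| * |∫ ω, Z p ω * Z q ω ∂P| := by
              rw [← abs_mul]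
              exact le_abs_self _
          _ ≤ |a p.1 p.2 * a q.1 q.2| * M p q := by gcongr
          _ ≤ (1 / 2 * (a p.1 p.2 ^ 2 + a q.1 q.2 ^ 2)) * M p q := by
              refine mul_le_mul_of_nonneg_right ?_ (h0.trans h1)
              rw [abs_mul, ← sq_abs (a p.1 p.2), ← sq_abs (a q.1 q.2)]
              nlinarith [sq_nonneg (|a p.1 p.2| - |a q.1 q.2|)]
          _ = _ := by ring
    _ = ∑ p ∈ T, a p.1 p.2 ^ 2 * ∑ q ∈ T, M p q := by
        simp only [Finset.sum_add_distrib]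
        rw [Finset.sum_comm (f := fun p q => 1 / 2 * (a q.1 q.2 ^ 2 * M q p)),
          ← Finset.sum_add_distrib]
        refine Finset.sum_congr rfl fun p _ => ?_
        rw [← Finset.sum_add_distrib, Finset.mul_sum]
        exact Finset.sum_congr rfl fun q _ => by ring
    _ ≤ ∑ p ∈ T, a p.1 p.2 ^ 2 * (2 * v ^ 2) := by
        gcongr with p _
        exact hMsum p
    _ = _ := by rw [← Finset.sum_mul]; ring

end QuadraticForm

/-! ### Random fields -/

/-- Almost surely, a centred square integrable i.i.d. field has a dual Dirichlet norm in dyadic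
boxes of the order of the volume. -/
theorem exists_field_bound (hd : 3 ≤ d) {Ω : Type*} [MeasurableSpace Ω] {P : Measure Ω}
    [IsProbabilityMeasure P] {ξ : Site d → Ω → ℝ} (hmeas : ∀ x, Measurable (ξ x))
    (hind : iIndepFun ξ P) (hid : ∀ x y, IdentDistrib (ξ x) (ξ y) P P)
    (hmean : ∫ ω, ξ 0 ω ∂P = 0) (hL2 : MemLp (ξ 0) 2 P) :
    ∃ K : ℝ, 0 ≤ K ∧ ∀ᵐ ω ∂P, ∀ᶠ k : ℕ in atTop, ∀ h : Site d → ℝ,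
      (∀ x ∉ box d (2 ^ k), h x = 0) → ∀ ε : ℝ, 0 < ε →
        ∑ x ∈ box d (2 ^ k), ξ x ω * h x ≤ ε * energy (box d (2 ^ k)) h +
          1 / (4 * ε) * (K * (box d (2 ^ k)).card) := by
  obtain ⟨C, hC, hG⟩ := exists_green hd
  choose G hG1 hG2 hG3 using hG
  set v := ∫ ω, ξ 0 ω ^ 2 ∂P with hv
  have hv0 : 0 ≤ v := integral_nonneg fun _ => sq_nonneg _
  have hL2' : ∀ x, MemLp (ξ x) 2 P := fun x => (hid x 0).memLp_iff.2 hL2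
  have hmean' : ∀ x, ∫ ω, ξ x ω ∂P = 0 := fun x => (hid x 0).integral_eq.trans hmean
  have hsq : ∀ x y, IdentDistrib (fun ω => ξ x ω ^ 2) (fun ω => ξ y ω ^ 2) P P := fun x y =>
    (hid x y).comp (u := fun s => s ^ 2) (by fun_prop)
  have hv' : ∀ x, ∫ ω, ξ x ω ^ 2 ∂P = v := fun x => (hsq x 0).integral_eq
  have hdiag := strong_law_box (by omega) (X := fun x ω => ξ x ω ^ 2)
    (fun x => (hL2' x).integrable_sq)
    (fun x y hxy => (hind.indepFun hxy).comp (φ := fun s => s ^ 2) (ψ := fun s => s ^ 2)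
      (by fun_prop) (by fun_prop)) hsq
  let off : ℕ → Ω → ℝ := fun k ω =>
    ∑ p ∈ (box d (2 ^ k)).offDiag, G (2 ^ k) p.1 p.2 * (ξ p.1 ω * ξ p.2 ω)
  have hpos : ∀ N, (0 : ℝ) < (box d N).card := fun N => by
    exact_mod_cast (box_nonempty N).card_pos
  -- Chebyshev: the second moment is at most 2v²C n (2^k + 1)², and n ≥ 2^k (2^k + 1)² as d ≥ 3. For
  -- d = 3 the resulting rate is of order 1/N, which is summable only along a sparse sequence of
  -- boxes.
  have hP : ∀ k, P {ω | ((box d (2 ^ k)).card : ℝ) ^ 2 ≤ off k ω ^ 2} ≤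
      ENNReal.ofReal (2 * v ^ 2 * C * (1 / 2) ^ k) := fun k => by
    obtain ⟨hi, hle⟩ := integral_sq_offDiag_le hind hmeas hL2' hmean' hv' (box d (2 ^ k))
      (G (2 ^ k))
    have h1 := mul_meas_ge_le_integral_of_nonneg (Eventually.of_forall fun ω => sq_nonneg _) hi
      (((box d (2 ^ k)).card : ℝ) ^ 2)
    set n : ℝ := ((box d (2 ^ k)).card : ℝ) with hn
    have h2 : ∑ p ∈ (box d (2 ^ k)).offDiag, G (2 ^ k) p.1 p.2 ^ 2 ≤
        n * (C * ((2 : ℝ) ^ k + 1) ^ 2) := by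
      calc _ ≤ ∑ p ∈ box d (2 ^ k) ×ˢ box d (2 ^ k), G (2 ^ k) p.1 p.2 ^ 2 :=
            Finset.sum_le_sum_of_subset_of_nonneg
              (fun p hp => Finset.mem_product.2
                ⟨(Finset.mem_offDiag.1 hp).1, (Finset.mem_offDiag.1 hp).2.1⟩)
              fun _ _ _ => sq_nonneg _
        _ = ∑ x ∈ box d (2 ^ k), ∑ y ∈ box d (2 ^ k), G (2 ^ k) x y ^ 2 := Finset.sum_product _ _ _
        _ ≤ ∑ x ∈ box d (2 ^ k), C * ((2 : ℝ) ^ k + 1) ^ 2 := by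
            gcongr with x hx
            have := hG3 (2 ^ k) x hx
            push_cast at this
            exact this
        _ = _ := by rw [Finset.sum_const, nsmul_eq_mul]
    have h3 : (2 : ℝ) ^ k * ((2 : ℝ) ^ k + 1) ^ 2 ≤ n := by
      have e : n = (2 * (2 : ℝ) ^ k + 1) ^ d := by rw [hn, card_box]; push_cast; ring
      have h4 : (0 : ℝ) < 2 ^ k := by positivity
      calc (2 : ℝ) ^ k * ((2 : ℝ) ^ k + 1) ^ 2
          ≤ (2 * (2 : ℝ) ^ k + 1) * (2 * (2 : ℝ) ^ k + 1) ^ 2 := by gcongr <;> linarith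
        _ = (2 * (2 : ℝ) ^ k + 1) ^ 3 := by ring
        _ ≤ _ := by rw [e]; exact pow_le_pow_right₀ (by linarith) hd
    have hn0 : 0 < n := hpos _
    have h5 : P.real {ω | n ^ 2 ≤ off k ω ^ 2} ≤ 2 * v ^ 2 * C * (1 / 2) ^ k := by
      have h6 : n ^ 2 * P.real {ω | n ^ 2 ≤ off k ω ^ 2} ≤
          2 * v ^ 2 * (n * (C * ((2 : ℝ) ^ k + 1) ^ 2)) :=
        (h1.trans hle).trans (by gcongr)
      have h7 : 2 * v ^ 2 * (n * (C * ((2 : ℝ) ^ k + 1) ^ 2)) ≤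
          n ^ 2 * (2 * v ^ 2 * C * (1 / 2) ^ k) := by
        have e : (1 / 2 : ℝ) ^ k = 1 / 2 ^ k := by rw [one_div_pow]
        have h8 : ((2 : ℝ) ^ k + 1) ^ 2 ≤ n * (1 / 2) ^ k := by
          rw [e, mul_one_div, le_div_iff₀ (by positivity), mul_comm]
          exact h3
        calc 2 * v ^ 2 * (n * (C * ((2 : ℝ) ^ k + 1) ^ 2))
            ≤ 2 * v ^ 2 * (n * (C * (n * (1 / 2) ^ k))) := by gcongr
          _ = _ := by ring
      exact le_of_mul_le_mul_left (h6.trans h7) (by positivity)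
    rw [← ENNReal.ofReal_toReal (measure_ne_top P {ω | n ^ 2 ≤ off k ω ^ 2})]
    exact ENNReal.ofReal_le_ofReal h5
  have hsum : ∑' k, P {ω | ((box d (2 ^ k)).card : ℝ) ^ 2 ≤ off k ω ^ 2} ≠ ⊤ := by
    refine ne_top_of_le_ne_top (Summable.tsum_ofReal_ne_top ?_) (ENNReal.tsum_le_tsum hP)
    exact (summable_geometric_of_lt_one (by norm_num) (by norm_num)).mul_left _
  -- The diagonal of the quadratic form contributes C(v + 1), the off-diagonal part 1.
  refine ⟨C * (v + 1) + 1, by positivity, ?_⟩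
  filter_upwards [hdiag, ae_eventually_notMem hsum] with ω hω1 hω2
  have h1 : ∀ᶠ N in atTop, (∑ x ∈ box d N, ξ x ω ^ 2) / ((box d N).card : ℝ) ≤ v + 1 :=
    hω1.eventually_le_const (by linarith)
  have h2 : Tendsto (fun k : ℕ => 2 ^ k) atTop atTop :=
    tendsto_pow_atTop_atTop_of_one_lt (r := (2 : ℕ)) (by norm_num)
  filter_upwards [h2.eventually h1, hω2] with k hk1 (hk2 : ¬_ ≤ _) h hh ε hε
  rw [div_le_iff₀ (hpos _)] at hk1
  refine (hG1 (2 ^ k) (fun x => ξ x ω) h hh ε hε).trans ?_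
  gcongr
  have h3 : off k ω ≤ (box d (2 ^ k)).card := by
    rw [not_le] at hk2
    exact (lt_of_pow_lt_pow_left₀ 2 (Nat.cast_nonneg _) hk2).le
  have h4 : ∑ x ∈ box d (2 ^ k), ∑ y ∈ box d (2 ^ k), G (2 ^ k) x y * (ξ x ω * ξ y ω) =
      ∑ x ∈ box d (2 ^ k), G (2 ^ k) x x * ξ x ω ^ 2 + off k ω := by
    rw [← Finset.sum_product', ← Finset.diag_union_offDiag,
      Finset.sum_union (Finset.disjoint_diag_offDiag _), Finset.sum_diag]
    congr 1
    exact Finset.sum_congr rfl fun x _ => by ring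
  have h5 : ∑ x ∈ box d (2 ^ k), G (2 ^ k) x x * ξ x ω ^ 2 ≤
      C * ((v + 1) * (box d (2 ^ k)).card) := by
    calc _ ≤ ∑ x ∈ box d (2 ^ k), C * ξ x ω ^ 2 := by
          gcongr with x hx
          exact hG2 (2 ^ k) x hx
      _ = C * ∑ x ∈ box d (2 ^ k), ξ x ω ^ 2 := by rw [Finset.mul_sum]
      _ ≤ _ := by gcongr
  rw [h4]
  linarith

/-- A dyadic box contains the doubled box and has radius at most 4N, so its volume is at most 4^d
times that of Λ_N. -/
theorem exists_dyadic {N : ℕ} (hN : 1 ≤ N) : 2 * N ≤ 2 ^ Nat.clog 2 (2 * N) ∧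
    2 ^ Nat.clog 2 (2 * N) ≤ 4 * N := by
  refine ⟨Nat.le_pow_clog (by norm_num) _, ?_⟩
  have h1 := Nat.pow_pred_clog_lt_self (b := 2) (by norm_num) (x := 2 * N) (by omega)
  have h2 : 0 < Nat.clog 2 (2 * N) := Nat.clog_pos (by norm_num) (by omega)
  obtain ⟨m, hm⟩ := Nat.exists_eq_succ_of_ne_zero h2.ne'
  rw [hm] at h1 ⊢
  rw [Nat.pred_succ] at h1
  rw [pow_succ]
  omega

theorem tendsto_clog : Tendsto (fun N => Nat.clog 2 (2 * N)) atTop atTop := by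
  rw [tendsto_atTop]
  intro m
  filter_upwards [eventually_ge_atTop (2 ^ m)] with N hN
  have h := (exists_dyadic (Nat.one_le_two_pow.trans hN)).1
  exact (Nat.pow_le_pow_iff_right (a := 2) (by norm_num)).1 (by omega)

/-! ### Quadratic growth of the potential and tilt bounds for model A -/

theorem le_quadratic_of_even {V : ℝ → ℝ} {C : ℝ} (hV : ContDiff ℝ 2 V) (heven : ∀ s, V (-s) = V s)
    (hC : ∀ s, iteratedDeriv 2 V s ≤ C) (s : ℝ) : V s ≤ C / 2 * s ^ 2 + V 0 := by
  have hdV : Differentiable ℝ V := hV.differentiable (by norm_num)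
  have hdV' : Differentiable ℝ (deriv V) := hV.differentiable_deriv_two
  -- This function is convex and even; convexity at the midpoint of s and -s shows that it is
  -- minimal at 0.
  set g : ℝ → ℝ := fun s => C / 2 * s ^ 2 - V s with hg
  have hdg : ∀ s, HasDerivAt g (C * s - deriv V s) s := fun s => by
    have h1 := ((hasDerivAt_pow 2 s).const_mul (C / 2)).sub (hdV s).hasDerivAt
    convert! h1 using 1
    simp
    ring
  have hdg' : deriv g = fun s => C * s - deriv V s := funext fun s => (hdg s).deriv
  have hddg : ∀ s, HasDerivAt (deriv g) (C - deriv (deriv V) s) s := fun s => by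
    rw [hdg']
    have h1 := ((hasDerivAt_id s).const_mul C).sub (hdV' s).hasDerivAt
    convert! h1 using 1
    simp
  have hconv : ConvexOn ℝ Set.univ g := by
    refine convexOn_univ_of_deriv2_nonneg (fun s => (hdg s).differentiableAt)
      (fun s => (hddg s).differentiableAt) fun s => ?_
    have h1 := hC s
    rw [iteratedDeriv_succ, iteratedDeriv_one] at h1
    simp only [Function.iterate_succ, Function.iterate_zero, Function.comp_apply, id]
    rw [(hddg s).deriv]
    linarith
  have h := hconv.2 (Set.mem_univ s) (Set.mem_univ (-s))
    (show (0 : ℝ) ≤ 1 / 2 by norm_num) (show (0 : ℝ) ≤ 1 / 2 by norm_num) (by norm_num)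
  simp only [smul_eq_mul, hg, heven] at h
  rw [show (1 / 2 : ℝ) * s + 1 / 2 * -s = 0 by ring] at h
  nlinarith

theorem tiltBound_modelA {Ω : Type*} [MeasurableSpace Ω] (P : Measure Ω) [IsProbabilityMeasure P]
    (d : ℕ) (hd : 3 ≤ d) (V : ℝ → ℝ) (A B C₂ : ℝ) (ξ : Site d → Ω → ℝ)
    (hM : IsModelA P V A B C₂ ξ) (hmean : ∫ ω, ξ 0 ω ∂P = 0) (hL2 : MemLp (ξ 0) 2 P)
    (u : Fin d → ℝ) :
    ∃ β t₀ : ℝ, 0 < β ∧ 0 < t₀ ∧ ∀ᵐ ω ∂P, ∀ᶠ N : ℕ in atTop,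
      TiltBound (gradGibbsA V (fun x => ξ x ω) (box d N) (dot u)) (box d N) u β t₀ ∧
      TiltBound (spatialAverage (fun Λ => gradGibbsA V (fun x => ξ x ω) Λ (dot u)) (box d N))
        (box d N) u β t₀ := by
  simp only [gradGibbsA_eq]
  have hA := hM.A_pos
  have hC := hM.C₂_pos
  obtain ⟨K, hK, hfield⟩ :=
    exists_field_bound hd hM.measurable hM.indep hM.identDistrib hmean hL2
  -- The first summand bounds the constants B over the bonds; the second is the field bound with ε =
  -- A/8 and volume ratio 4^d.
  set κ : ℝ := 2 * d * |B| + 1 / (4 * (A / 8)) * (K * 4 ^ d) with hκ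
  refine ⟨A / 16, max 1 (16 / A * FiniteVolumeBounds.momentConst d u A (C₂ / 2) |V 0| κ),
    by positivity, lt_max_of_lt_left one_pos, ?_⟩
  filter_upwards [hfield] with ω hω
  filter_upwards [tendsto_clog.eventually hω, eventually_ge_atTop 1] with N hN hN1
  refine tiltBound_box_and_average (b := fun _ _ => |B|) (by omega) u (fun Λ hΛ hcard => ?_)
    (le_max_right _ _)
  set M := 2 ^ Nat.clog 2 (2 * N) with hMdef
  have hsub : Λ ⊆ box d M := hΛ.trans (box_mono (exists_dyadic hN1).1)
  have hcardM : ((box d M).card : ℝ) ≤ 4 ^ d * Λ.card := by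
    rw [hcard]
    exact_mod_cast (Finset.card_le_card (box_mono (exists_dyadic hN1).2)).trans
      (card_box_mul_le 4 N (by norm_num))
  exact
    { measurable := fun _ _ _ => hM.contDiff.continuous.measurable
      A_pos := hA
      C_pos := by positivity
      c₀_nonneg := abs_nonneg _
      upper := fun _ _ _ s => (le_quadratic_of_even hM.contDiff hM.even hM.second_deriv_le s).trans
        (by linarith [le_abs_self (V 0)])
      lower := fun _ _ _ s => le_trans (by linarith [le_abs_self B]) (hM.lower s)
      bondSum_le := by
        refine (bondSum_const_le Λ (abs_nonneg B)).trans ?_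
        gcongr
        exact le_add_of_nonneg_right (by positivity)
      field_le := fun h hh => by
        -- As h vanishes off Λ, neither its energy nor ∑ ξ h changes in the dyadic box, so a single
        -- almost sure event covers every subvolume.
        have h1 := hN h (fun x hx => hh x fun hx' => hx (hsub hx')) (A / 8) (by positivity)
        have h2 : ∑ x ∈ Λ, ξ x ω * h x = ∑ x ∈ box d M, ξ x ω * h x :=
          Finset.sum_subset hsub fun x _ hx => by rw [hh x hx, mul_zero]
        rw [h2, energy_eq_of_le hh hsub]
        refine h1.trans ?_
        refine add_le_add_right ?_ _
        calc 1 / (4 * (A / 8)) * (K * (box d M).card)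
            ≤ 1 / (4 * (A / 8)) * (K * (4 ^ d * Λ.card)) := by gcongr
          _ = 1 / (4 * (A / 8)) * (K * 4 ^ d) * Λ.card := by ring
          _ ≤ _ := by
              gcongr
              exact le_add_of_nonneg_left (by positivity) }

end Interface

theorem mainTheorem8 {Ω : Type*} [MeasurableSpace Ω] (P : Measure Ω) [IsProbabilityMeasure P] :
    -- Model A
    (∀ (d : ℕ) (_ : 3 ≤ d) (V : ℝ → ℝ) (A B C₂ : ℝ) (ξ : Interface.Site d → Ω → ℝ)
        (_ : Interface.IsModelA P V A B C₂ ξ)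
        (_ : ∫ ω, ξ 0 ω ∂P = 0) (_ : MemLp (ξ 0) 2 P) (u : Fin d → ℝ),
      ∃ β t₀ : ℝ, 0 < β ∧ 0 < t₀ ∧ ∀ᵐ ω ∂P, ∀ᶠ N : ℕ in atTop,
        Interface.TiltBound
          (Interface.gradGibbsA V (fun x => ξ x ω) (Interface.box d N) (Interface.dot u))
          (Interface.box d N) u β t₀ ∧
        Interface.TiltBound
          (Interface.spatialAverage
            (fun Λ => Interface.gradGibbsA V (fun x => ξ x ω) Λ (Interface.dot u))
            (Interface.box d N))
          (Interface.box d N) u β t₀) ∧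
    -- Model B
    (∀ (d : ℕ) (_ : 1 ≤ d) (V : Interface.Site d → Interface.Site d → Ω → ℝ → ℝ) (A C₂ : ℝ)
        (B : Interface.Site d → Interface.Site d → Ω → ℝ)
        (_ : Interface.IsModelB P V A C₂ B) (u : Fin d → ℝ),
      ∃ β t₀ : ℝ, 0 < β ∧ 0 < t₀ ∧
        (∀ᵐ ω ∂P,
          -- all large volumes, with the nonrandom threshold
          (∀ᶠ N : ℕ in atTop,
            Interface.TiltBound
              (Interface.gradGibbsB (fun x y => V x y ω) (Interface.box d N) (Interface.dot u))
              (Interface.box d N) u β t₀ ∧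
            Interface.TiltBound
              (Interface.spatialAverage
                (fun Λ => Interface.gradGibbsB (fun x y => V x y ω) Λ (Interface.dot u))
                (Interface.box d N))
              (Interface.box d N) u β t₀) ∧
          -- all volumes, with a threshold that may depend on the disorder
          (∃ t₁ : ℝ, 0 < t₁ ∧ ∀ N : ℕ,
            Interface.TiltBound
              (Interface.gradGibbsB (fun x y => V x y ω) (Interface.box d N) (Interface.dot u))
              (Interface.box d N) u β t₁ ∧
            Interface.TiltBound
              (Interface.spatialAverage
                (fun Λ => Interface.gradGibbsB (fun x y => V x y ω) Λ (Interface.dot u))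
                (Interface.box d N))
              (Interface.box d N) u β t₁)) ∧
        -- all volumes, with the nonrandom threshold, if the variables `B` are bounded above
        ((∃ b : ℝ, ∀ᵐ ω ∂P, ∀ x y, Interface.Adj x y → B x y ω ≤ b) →
          ∀ᵐ ω ∂P, ∀ N : ℕ,
            Interface.TiltBound
              (Interface.gradGibbsB (fun x y => V x y ω) (Interface.box d N) (Interface.dot u))
              (Interface.box d N) u β t₀ ∧
            Interface.TiltBound
              (Interface.spatialAverage
                (fun Λ => Interface.gradGibbsB (fun x y => V x y ω) Λ (Interface.dot u))
                (Interface.box d N))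
              (Interface.box d N) u β t₀)) :=
  ⟨fun d hd V A B C₂ ξ hM hmean hL2 u =>
      Interface.tiltBound_modelA P d hd V A B C₂ ξ hM hmean hL2 u,
    fun d hd V A C₂ B hM u => Interface.tiltBound_modelB P d hd V A C₂ B hM u⟩
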